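/- **Theorem.** Let $\mathbf{Cat}$ be the category of small categories and functors, and let $\mathbf{Dist}$ be the bicategory of small categories and distributors: a 1-cell $M : A ⇸ B$ is a functor $M : B^{op}\times A\to\mathbf{Set}$, a 2-cell is a natural transformation, the identity of $A$ is $\hom_A$, and the composite of $M : A ⇸ B$ and $N : B ⇸ C$ is $(N\circ M)(c,a)=\int^{b\in B}N(c,b)\times M(b,a)$. Let $\mathbf{PSH}$ be the bicategory whose objects over a small category $A$ are distributors $R : 1 ⇸ A$ (that is, contravariant presheaves $R : A^{op}\to\mathbf{Set}$), whose 1-cells $(A,R)\to(B,S)$ are pairs $(M,\alpha)$ of a distributor $M : A ⇸ B$ and a 2-cell $\alpha : M\circ R\Rightarrow S$, and whose 2-cells $(M,\alpha)\Rightarrow(N,\beta)$ are the 2-cells $\theta : M\Rightarrow N$ with $\beta\cdot(\theta\circ R)=\alpha$. Let $p : \mathbf{PSH}\to\mathbf{Dist}$ be the projection. Let $\mathbf{Psh}^+$ and $\mathbf{Psh}^-$ be the categories whose objects are pairs $(A,R)$ of a small category $A$ and a presheaf $R : A^{op}\to\mathbf{Set}$. A morphism $(A,R)\to(B,S)$ of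 $\mathbf{Psh}^+$ is a functor $F : A\to B$ with a natural transformation $\alpha : R\Rightarrow S\circ F^{op}$; a morphism $(A,R)\to(B,S)$ of $\mathbf{Psh}^-$ is a functor $F : B\to A$ with a natural transformation $\alpha : R\circ F^{op}\Rightarrow S$. Let $p^+ : \mathbf{Psh}^+\to\mathbf{Cat}$ and $p^- : \mathbf{Psh}^-\to\mathbf{Cat}^{op}$ be the projections. For a functor $F : A\to B$ put $$F^+ = (b,a)\mapsto\hom_B(b,Fa) : A ⇸ B,\qquad F^- = (a,b)\mapsto\hom_B(Fa,b) : B ⇸ A .$$ With the canonical coherence isomorphisms these give identity-on-objects pseudofunctors $\mathrm{emb}^+ : \mathbf{Cat}\to\mathbf{Dist}$ and $\mathrm{emb}^- : \mathbf{Cat}^{op}\to\mathbf{Dist}$, where $\mathbf{Cat}$, $\mathbf{Cat}^{op}$, $\mathbf{Psh}^+$, $\mathbf{Psh}^-$ are regarded as bicategories with only identity 2-cells. For $M : A ⇸ B$, $R : A^{op}\to\mathbf{Set}$ and $S : B^{op}\to\mathbf{Set}$ put $$\exists_M R = b\mapsto\int^{a\in A}M(b,a)\times R(a),\qquad \forall_M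 S = a\mapsto\int_{b\in B}\big(M(b,a)\to S(b)\big),$$ and for a functor $F : A\to B$ put $F^*S = a\mapsto S(Fa)$ and $$\Sigma_F R = b\mapsto\int^{a\in A}\hom_B(b,Fa)\times R(a),\qquad \Pi_F R = b\mapsto\int_{a\in A}\big(\hom_B(Fa,b)\to R(a)\big).$$ In $p$, a 1-cell $\varphi : R\to S$ over $M : A ⇸ B$ is a *pushforward* of $R$ along $M$ if, for every $T$ and every $N : B ⇸ p(T)$, precomposition with $\varphi$ is a bijection from the 1-cells $S\to T$ over $N$ to the 1-cells $R\to T$ over $N\circ M$; it is a *pullback* of $S$ along $M$ if, for every $T$ and every $N : p(T) ⇸ A$, postcomposition with $\varphi$ is a bijection from the 1-cells $T\to R$ over $N$ to the 1-cells $T\to S$ over $M\circ N$. Then: 1. $p$ is a bifibration (pushforwards and pullbacks exist along every distributor), and $p^+$ and $p^-$ are bifibrations of categories (fibrations and opfibrations). 2. The square with sides $p^+$, $\mathrm{emb}^+$, $p$ and the comparison $\mathbf{Psh}^+\to\mathbf{PSH}$, $(A,R)\mapsto(A,R)$, $(F,\alpha)\mapsto(F^+,\,[h,r]\mapsto S(h)(\alpha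 r))$, and the square with sides $p^-$, $\mathrm{emb}^-$, $p$ and the comparison $\mathbf{Psh}^-\to\mathbf{PSH}$, $(A,R)\mapsto(A,R)$, $(F,\alpha)\mapsto(F^-,\,[h,r]\mapsto\alpha(R(h)r))$, are pullbacks in the category of bicategories and pseudofunctors. That is, $p^+$ and $p^-$ are the pullbacks of $p$ along $\mathrm{emb}^+$ and $\mathrm{emb}^-$. 3. For every $M : A ⇸ B$ there is an adjunction $\exists_M\dashv\forall_M$ with unit $r\mapsto(m\mapsto[m,r])$. There are 1-cells $(M,\mathrm{push}_R) : R\to\exists_M R$ and $(M,\mathrm{pull}_S) : \forall_M S\to S$ of $\mathbf{PSH}$ over $M$ which are, respectively, a pushforward of $R$ and a pullback of $S$ along $M$, and $f : \exists_M R\Rightarrow S$ corresponds to $g : R\Rightarrow\forall_M S$ under the adjunction exactly when $f\cdot\mathrm{push}_R=\mathrm{pull}_S\cdot(M\circ g)$ as 2-cells $M\circ R\Rightarrow S$. 4. For every functor $F : A\to B$ there are adjunctions $\Sigma_F\dashv F^*\dashv\Pi_F$, the first with unit $r\mapsto[\mathrm{id}_{Fa},r]$ and the second with counit $z\mapsto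 z_a(\mathrm{id}_{Fa})$, and canonical natural isomorphisms $$\Sigma_F\cong\exists_{F^+},\qquad \forall_{F^+}\cong F^*\cong\exists_{F^-},\qquad \Pi_F\cong\forall_{F^-}$$ (given by $[h,r]\mapsto[h,r]$; by $s\mapsto(h\mapsto S(h)s)$ and $s\mapsto[\mathrm{id}_{Fa},s]$; and by $z\mapsto z$) which carry $\exists_{F^+}\dashv\forall_{F^+}$ to $\Sigma_F\dashv F^*$ and $\exists_{F^-}\dashv\forall_{F^-}$ to $F^*\dashv\Pi_F$. Moreover, $p^+$ and $p^-$ encode these operations: in $p^+$ the unit $R\Rightarrow(\Sigma_F R)\circ F^{op}$ is a cocartesian morphism $(A,R)\to(B,\Sigma_F R)$ over $F$ and the identity is a cartesian morphism $(A,F^*S)\to(B,S)$ over $F$; in $p^-$ the identity is a cocartesian morphism $(B,S)\to(A,F^*S)$ and the counit $(\Pi_F R)\circ F^{op}\Rightarrow R$ is a cartesian morphism $(B,\Pi_F R)\to(A,R)$ over $F$ viewed as a morphism $B\to A$ of $\mathbf{Cat}^{op}$. -/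

import Mathlib

open CategoryTheory Opposite Bicategory Limits

namespace PresheafBifibration

universe u

/-! ### Coends and ends of set-valued functors -/

section Ends

variable {J : Type u} [Category.{u} J]

/-- The relation generating the coend of `P`: every `x ∈ P(j, i)` and `f : i ⟶ j` identify
the two images of `x` in `P(i, i)` and in `P(j, j)`. -/
inductive CoendRel (P : Jᵒᵖ ⥤ J ⥤ Type u) :
    (Σ j : J, (P.obj (op j)).obj j) → (Σ j : J, (P.obj (op j)).obj j) → Prop
  | glue {i j : J} (f : i ⟶ j) (x : (P.obj (op j)).obj i) :
      CoendRel P ⟨i, (P.map f.op).app i x⟩ ⟨j, (P.obj (op j)).map f x⟩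

/-- The coend `∫^j P(j, j)` of a set-valued functor. -/
def TypeCoend (P : Jᵒᵖ ⥤ J ⥤ Type u) : Type u := Quot (CoendRel P)

/-- The end `∫_j P(j, j)` of a set-valued functor. -/
def TypeEnd (P : Jᵒᵖ ⥤ J ⥤ Type u) : Type u :=
  { x : ∀ j : J, (P.obj (op j)).obj j //
    ∀ ⦃i j : J⦄ (f : i ⟶ j), (P.obj (op i)).map f (x i) = (P.map f.op).app j (x j) }

/-- The universal cowedge on `TypeCoend P`. -/
def coendCowedge (P : Jᵒᵖ ⥤ J ⥤ Type u) : Cowedge P :=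
  Cowedge.mk (TypeCoend P) (fun j => ↾ fun x => (Quot.mk _ ⟨j, x⟩ : TypeCoend P))
    (fun _ _ f => by ext x; exact Quot.sound (CoendRel.glue f x))

/-- `TypeCoend P` is a coend of `P`. -/
def coendIsColimit (P : Jᵒᵖ ⥤ J ⥤ Type u) : IsColimit (coendCowedge P) :=
  Multicofork.IsColimit.mk _
    (fun K => ↾ fun t => Quot.lift
      (fun s : (Σ j : J, (P.obj (op j)).obj j) => K.π s.1 s.2)
      (by
        rintro _ _ ⟨f, x⟩
        exact types_congr_hom (Cowedge.condition K f) x) t)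
    (fun K j => rfl)
    (fun K m hm => by
      ext t
      induction t using Quot.ind with
      | mk s => exact types_congr_hom (hm s.1) s.2)

/-- The universal wedge on `TypeEnd P`. -/
def endWedge (P : Jᵒᵖ ⥤ J ⥤ Type u) : Wedge P :=
  Wedge.mk (TypeEnd P) (fun j => ↾ fun x => x.1 j) (fun _ _ f => by ext x; exact x.2 f)

/-- `TypeEnd P` is an end of `P`. -/
def endIsLimit (P : Jᵒᵖ ⥤ J ⥤ Type u) : IsLimit (endWedge P) :=
  Multifork.IsLimit.mk _
    (fun K => ↾ fun t => (⟨fun j => K.ι j t, fun _ _ f =>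
      types_congr_hom (Wedge.condition K f) t⟩ : TypeEnd P))
    (fun K j => rfl)
    (fun K m hm => by
      ext t
      exact Subtype.ext (funext fun j => types_congr_hom (hm j) t))

/-- The integrand `(j', j) ↦ X(j) × Y(j')`. -/
def prodIntegrand (X : J ⥤ Type u) (Y : Jᵒᵖ ⥤ Type u) : Jᵒᵖ ⥤ J ⥤ Type u where
  obj j' :=
    { obj := fun j => X.obj j × Y.obj j'
      map := fun f => ↾ fun t => (X.map f t.1, t.2)
      map_id := by intro; ext t <;> simp
      map_comp := by intros; ext t <;> simp }
  map g := { app := fun j => ↾ fun t => (t.1, Y.map g t.2) }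
  map_id := by intro; ext j t <;> simp
  map_comp := by intros; ext j t <;> simp

/-- The integrand `(j', j) ↦ (X(j) → Y(j'))`. -/
def funIntegrand (X Y : Jᵒᵖ ⥤ Type u) : Jᵒᵖ ⥤ J ⥤ Type u where
  obj j' :=
    { obj := fun j => X.obj (op j) → Y.obj j'
      map := fun f => ↾ fun h x => h (X.map f.op x)
      map_id := by intro; ext h x; simp
      map_comp := by intros; ext h x; simp }
  map g := { app := fun j => ↾ fun h x => Y.map g (h x) }
  map_id := by intro; ext j h x; simp
  map_comp := by intros; ext j h x; simp

end Ends

section Tensor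

variable {J : Type u} [Category.{u} J]

/-- The coend `∫^j X(j) × Y(j)`. -/
abbrev Tensor (X : J ⥤ Type u) (Y : Jᵒᵖ ⥤ Type u) : Type u := TypeCoend (prodIntegrand X Y)

namespace Tensor

/-- The class of `(x, y) ∈ X(j) × Y(j)` in the coend. -/
def mk {X : J ⥤ Type u} {Y : Jᵒᵖ ⥤ Type u} (j : J) (x : X.obj j) (y : Y.obj (op j)) :
    Tensor X Y := Quot.mk _ ⟨j, (x, y)⟩

theorem glue {X : J ⥤ Type u} {Y : Jᵒᵖ ⥤ Type u} {i j : J} (f : i ⟶ j) (x : X.obj i)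
    (y : Y.obj (op j)) : (mk i x (Y.map f.op y) : Tensor X Y) = mk j (X.map f x) y :=
  Quot.sound (CoendRel.glue (P := prodIntegrand X Y) f (x, y))

theorem ind {X : J ⥤ Type u} {Y : Jᵒᵖ ⥤ Type u} {motive : Tensor X Y → Prop}
    (h : ∀ j x y, motive (mk j x y)) (t : Tensor X Y) : motive t :=
  Quot.ind (fun s => h s.1 s.2.1 s.2.2) t

/-- The function out of the coend induced by a compatible family of functions. -/
def lift {X : J ⥤ Type u} {Y : Jᵒᵖ ⥤ Type u} {Z : Type u}
    (φ : ∀ j : J, X.obj j → Y.obj (op j) → Z)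
    (h : ∀ ⦃i j : J⦄ (f : i ⟶ j) (x : X.obj i) (y : Y.obj (op j)),
      φ i x (Y.map f.op y) = φ j (X.map f x) y) (t : Tensor X Y) : Z :=
  Quot.lift (fun s => φ s.1 s.2.1 s.2.2) (by rintro _ _ ⟨f, x⟩; exact h f x.1 x.2) t

@[simp] theorem lift_mk {X : J ⥤ Type u} {Y : Jᵒᵖ ⥤ Type u} {Z : Type u}
    (φ : ∀ j : J, X.obj j → Y.obj (op j) → Z)
    (h : ∀ ⦃i j : J⦄ (f : i ⟶ j) (x : X.obj i) (y : Y.obj (op j)),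
      φ i x (Y.map f.op y) = φ j (X.map f x) y) (j : J) (x : X.obj j) (y : Y.obj (op j)) :
    lift φ h (mk j x y) = φ j x y := rfl

/-- Functoriality of the coend. -/
def map {X X' : J ⥤ Type u} {Y Y' : Jᵒᵖ ⥤ Type u} (f : X ⟶ X') (g : Y ⟶ Y')
    (t : Tensor X Y) : Tensor X' Y' :=
  lift (fun j x y => mk j (f.app j x) (g.app (op j) y)) (by
    intro i j k x y
    rw [NatTrans.naturality_apply, NatTrans.naturality_apply, glue]) t

@[simp] theorem map_mk {X X' : J ⥤ Type u} {Y Y' : Jᵒᵖ ⥤ Type u} (f : X ⟶ X') (g : Y ⟶ Y')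
    (j : J) (x : X.obj j) (y : Y.obj (op j)) :
    map f g (mk j x y) = mk j (f.app j x) (g.app (op j) y) := rfl

@[simp] theorem map_id {X : J ⥤ Type u} {Y : Jᵒᵖ ⥤ Type u} (t : Tensor X Y) :
    map (𝟙 X) (𝟙 Y) t = t := by
  induction t using ind with
  | h j x y => rfl

theorem map_comp {X X' X'' : J ⥤ Type u} {Y Y' Y'' : Jᵒᵖ ⥤ Type u} (f : X ⟶ X') (f' : X' ⟶ X'')
    (g : Y ⟶ Y') (g' : Y' ⟶ Y'') (t : Tensor X Y) :
    map (f ≫ f') (g ≫ g') t = map f' g' (map f g t) := by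
  induction t using ind with
  | h j x y => rfl

end Tensor

/-- The end `∫_j (X(j) → Y(j))`. -/
abbrev Cotensor (X Y : Jᵒᵖ ⥤ Type u) : Type u := TypeEnd (funIntegrand X Y)

namespace Cotensor

/-- Functoriality of the end. -/
def map {X X' Y Y' : Jᵒᵖ ⥤ Type u} (f : X' ⟶ X) (g : Y ⟶ Y') (t : Cotensor X Y) : Cotensor X' Y' :=
  ⟨fun j x => g.app (op j) (t.1 j (f.app (op j) x)), fun i j k => by
    funext x
    change g.app (op i) (t.1 i (f.app (op i) (X'.map k.op x))) =
      Y'.map k.op (g.app (op j) (t.1 j (f.app (op j) x)))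
    have e₁ : f.app (op i) (X'.map k.op x) = X.map k.op (f.app (op j) x) :=
      NatTrans.naturality_apply f k.op x
    have e₂ : t.1 i (X.map k.op (f.app (op j) x)) = Y.map k.op (t.1 j (f.app (op j) x)) :=
      congrFun (t.2 k) (f.app (op j) x)
    rw [e₁, e₂]
    exact NatTrans.naturality_apply g k.op _⟩

@[simp] theorem map_id {X Y : Jᵒᵖ ⥤ Type u} (t : Cotensor X Y) : map (𝟙 X) (𝟙 Y) t = t := rfl

theorem map_comp {X X' X'' Y Y' Y'' : Jᵒᵖ ⥤ Type u} (f : X' ⟶ X) (f' : X'' ⟶ X')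
    (g : Y ⟶ Y') (g' : Y' ⟶ Y'') (t : Cotensor X Y) :
    map (f' ≫ f) (g ≫ g') t = map f' g' (map f g t) := rfl

end Cotensor

end Tensor

/-! ### Distributors -/

section Distributors

/-- A distributor `A ⇸ B` between small categories. -/
abbrev Distributor (A B : Type u) [Category.{u} A] [Category.{u} B] : Type (u + 1) :=
  Bᵒᵖ × A ⥤ Type u

namespace Distributor

variable {A B C D : Type u} [Category.{u} A] [Category.{u} B] [Category.{u} C] [Category.{u} D]

open scoped CategoryTheory.Prod

/-- The covariant functor `M(b, -)`. -/
def row (M : Distributor A B) (b : Bᵒᵖ) : A ⥤ Type u where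
  obj a := M.obj (b, a)
  map f := M.map (𝟙 b ×ₘ f)
  map_id a := M.map_id (b, a)
  map_comp f g := by rw [← M.map_comp]; simp

/-- The presheaf `M(-, a)`. -/
def col (M : Distributor A B) (a : A) : Bᵒᵖ ⥤ Type u where
  obj b := M.obj (b, a)
  map g := M.map (g ×ₘ 𝟙 a)
  map_id b := M.map_id (b, a)
  map_comp f g := by rw [← M.map_comp]; simp

theorem map_apply_eq (M : Distributor A B) {b b' b'' : Bᵒᵖ} {a a' a'' : A} (g : b ⟶ b')
    (f : a ⟶ a') (g' : b' ⟶ b'') (f' : a' ⟶ a'') (m : M.obj (b, a)) :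
    M.map (g' ×ₘ f') (M.map (g ×ₘ f) m) = M.map ((g ≫ g') ×ₘ (f ≫ f')) m :=
  (M.map_comp_apply (g ×ₘ f) (g' ×ₘ f') m).symm

theorem map_row_col (M : Distributor A B) {b b' : Bᵒᵖ} {a a' : A} (g : b ⟶ b') (f : a ⟶ a') :
    M.map (g ×ₘ 𝟙 a) ≫ M.map (𝟙 b' ×ₘ f) = M.map (g ×ₘ f) := by
  rw [← M.map_comp]; simp

theorem map_col_row (M : Distributor A B) {b b' : Bᵒᵖ} {a a' : A} (g : b ⟶ b') (f : a ⟶ a') :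
    M.map (𝟙 b ×ₘ f) ≫ M.map (g ×ₘ 𝟙 a') = M.map (g ×ₘ f) := by
  rw [← M.map_comp]; simp

/-- The action of `g` on rows. -/
def rowMap (M : Distributor A B) {b b' : Bᵒᵖ} (g : b ⟶ b') : M.row b ⟶ M.row b' where
  app a := M.map (g ×ₘ 𝟙 a)
  naturality _ _ f := (M.map_col_row g f).trans (M.map_row_col g f).symm

/-- The action of `f` on columns. -/
def colMap (M : Distributor A B) {a a' : A} (f : a ⟶ a') : M.col a ⟶ M.col a' where
  app b := M.map (𝟙 b ×ₘ f)
  naturality _ _ g := (M.map_row_col g f).trans (M.map_col_row g f).symm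


@[simp] theorem rowMap_id (M : Distributor A B) (b : Bᵒᵖ) : M.rowMap (𝟙 b) = 𝟙 (M.row b) := by
  ext a : 2
  exact M.map_id (b, a)

@[simp] theorem rowMap_comp (M : Distributor A B) {b b' b'' : Bᵒᵖ} (g : b ⟶ b') (g' : b' ⟶ b'') :
    M.rowMap (g ≫ g') = M.rowMap g ≫ M.rowMap g' := by
  ext a : 2
  refine Eq.trans ?_ (M.map_comp (g ×ₘ 𝟙 a) (g' ×ₘ 𝟙 a))
  exact congrArg (fun k => M.map ((g ≫ g') ×ₘ k)) (Category.comp_id (𝟙 a)).symm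

@[simp] theorem colMap_id (M : Distributor A B) (a : A) : M.colMap (𝟙 a) = 𝟙 (M.col a) := by
  ext b : 2
  exact M.map_id (b, a)

@[simp] theorem colMap_comp (M : Distributor A B) {a a' a'' : A} (f : a ⟶ a') (f' : a' ⟶ a'') :
    M.colMap (f ≫ f') = M.colMap f ≫ M.colMap f' := by
  ext b : 2
  refine Eq.trans ?_ (M.map_comp (𝟙 b ×ₘ f) (𝟙 b ×ₘ f'))
  exact congrArg (fun k => M.map (k ×ₘ (f ≫ f'))) (Category.comp_id (𝟙 b)).symm

/-- The restriction of a 2-cell to a row. -/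
def rowHom {M M' : Distributor A B} (η : M ⟶ M') (b : Bᵒᵖ) : M.row b ⟶ M'.row b where
  app a := η.app (b, a)
  naturality _ _ f := η.naturality (𝟙 b ×ₘ f)

/-- The restriction of a 2-cell to a column. -/
def colHom {M M' : Distributor A B} (η : M ⟶ M') (a : A) : M.col a ⟶ M'.col a where
  app b := η.app (b, a)
  naturality _ _ g := η.naturality (g ×ₘ 𝟙 a)

/-- The identity distributor `hom_A`. -/
def id (A : Type u) [Category.{u} A] : Distributor A A where
  obj x := x.1.unop ⟶ x.2
  map f := ↾ fun h => f.1.unop ≫ h ≫ f.2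
  map_id := by intro; ext; simp
  map_comp := by intros; ext; simp

/-- The composite `A ⇸ B ⇸ C`, sending `(c, a)` to `∫^b N(c, b) × M(b, a)`. -/
def comp (M : Distributor A B) (N : Distributor B C) : Distributor A C where
  obj x := Tensor (N.row x.1) (M.col x.2)
  map f := ↾ Tensor.map (N.rowMap f.1) (M.colMap f.2)
  map_id x := by ext t; simp
  map_comp f g := by ext t; simp [Tensor.map_comp]

/-- Horizontal composition of 2-cells. -/
def hcomp {M M' : Distributor A B} {N N' : Distributor B C} (μ : M ⟶ M') (ν : N ⟶ N') :
    comp M N ⟶ comp M' N' where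
  app x := ↾ Tensor.map (rowHom ν x.1) (colHom μ x.2)
  naturality x y f := by
    ext t
    induction t using Tensor.ind with
    | h b n m =>
      exact congrArg₂ (Tensor.mk (X := N'.row y.1) (Y := M'.col y.2) b)
        (NatTrans.naturality_apply ν (f.1 ×ₘ 𝟙 b) n)
        (NatTrans.naturality_apply μ (𝟙 (op b) ×ₘ f.2) m)

theorem hom_ext {M N : Distributor A B} {μ ν : M ⟶ N}
    (h : ∀ (b : Bᵒᵖ) (a : A) (m : M.obj (b, a)), μ.app (b, a) m = ν.app (b, a) m) : μ = ν := by
  ext ⟨b, a⟩ m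
  exact h b a m

theorem comp_hom_ext {M : Distributor A B} {N : Distributor B C} {L : Distributor A C}
    {μ ν : comp M N ⟶ L}
    (h : ∀ (c : Cᵒᵖ) (a : A) (b : B) (n : N.obj (c, b)) (m : M.obj (op b, a)),
      μ.app (c, a) (Tensor.mk (X := N.row c) (Y := M.col a) b n m) =
        ν.app (c, a) (Tensor.mk (X := N.row c) (Y := M.col a) b n m)) : μ = ν := by
  ext ⟨c, a⟩ t
  induction t using Tensor.ind with
  | h b n m => exact h c a b n m

theorem comp_row_map_mk (M : Distributor A B) (N : Distributor B C) (c : Cᵒᵖ) {a a' : A}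
    (f : a ⟶ a') (b : B) (n : N.obj (c, b)) (m : M.obj (op b, a)) :
    ((comp M N).row c).map f (Tensor.mk (X := N.row c) (Y := M.col a) b n m) =
      Tensor.mk (X := N.row c) (Y := M.col a') b n ((M.row (op b)).map f m) :=
  congrArg (fun k => Tensor.mk (X := N.row c) (Y := M.col a') b k ((M.row (op b)).map f m))
    (N.map_id_apply (c, b) n)

theorem comp_col_map_mk (M : Distributor A B) (N : Distributor B C) {c c' : Cᵒᵖ} (a : A)
    (g : c ⟶ c') (b : B) (n : N.obj (c, b)) (m : M.obj (op b, a)) :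
    ((comp M N).col a).map g (Tensor.mk (X := N.row c) (Y := M.col a) b n m) =
      Tensor.mk (X := N.row c') (Y := M.col a) b ((N.col b).map g n) m :=
  congrArg (fun k => Tensor.mk (X := N.row c') (Y := M.col a) b ((N.col b).map g n) k)
    (M.map_id_apply (op b, a) m)

/-- The associativity 2-cell `[l, [n, m]] ↦ [[l, n], m]`. -/
def assocHom (M : Distributor A B) (N : Distributor B C) (L : Distributor C D) :
    comp (comp M N) L ⟶ comp M (comp N L) where
  app x := ↾ Tensor.lift
    (fun c l => Tensor.lift
      (fun b n m => Tensor.mk (X := (comp N L).row x.1) (Y := M.col x.2) b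
        (Tensor.mk (X := L.row x.1) (Y := N.col b) c l n) m)
      (by
        intro b b' f n m
        refine (Tensor.glue (X := (comp N L).row x.1) (Y := M.col x.2) f
          (Tensor.mk (X := L.row x.1) (Y := N.col b) c l n) m).trans ?_
        exact congrArg (fun t => Tensor.mk (X := (comp N L).row x.1) (Y := M.col x.2) b' t m)
          (comp_row_map_mk N L x.1 f c l n)))
    (by
      intro c c' f l s
      induction s using Tensor.ind with
      | h b n m =>
        refine (congrArg _ (comp_col_map_mk M N x.2 f.op b n m)).trans ?_
        exact congrArg
          (fun t => Tensor.mk (X := (comp N L).row x.1) (Y := M.col x.2) b t m)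
          (Tensor.glue (X := L.row x.1) (Y := N.col b) f l n))
  naturality x y f := by
    ext t
    induction t using Tensor.ind with
    | h c l s =>
      induction s using Tensor.ind with
      | h b n m =>
        rfl

/-- The inverse associativity 2-cell `[[l, n], m] ↦ [l, [n, m]]`. -/
def assocInv (M : Distributor A B) (N : Distributor B C) (L : Distributor C D) :
    comp M (comp N L) ⟶ comp (comp M N) L where
  app x := ↾ Tensor.lift
    (fun b s m => Tensor.lift
      (fun c l n => Tensor.mk (X := L.row x.1) (Y := (comp M N).col x.2) c l
        (Tensor.mk (X := N.row (op c)) (Y := M.col x.2) b n m))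
      (by
        intro c c' f l n
        refine Eq.trans ?_ (Tensor.glue (X := L.row x.1) (Y := (comp M N).col x.2) f l
          (Tensor.mk (X := N.row (op c')) (Y := M.col x.2) b n m))
        exact congrArg (fun t => Tensor.mk (X := L.row x.1) (Y := (comp M N).col x.2) c l t)
          (comp_col_map_mk M N x.2 f.op b n m).symm) s)
    (by
      intro b b' f s m
      induction s using Tensor.ind with
      | h c l n =>
        refine Eq.trans ?_ (congrArg _ (comp_row_map_mk N L x.1 f c l n)).symm
        exact congrArg
          (fun t => Tensor.mk (X := L.row x.1) (Y := (comp M N).col x.2) c l t)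
          (Tensor.glue (X := N.row (op c)) (Y := M.col x.2) f n m))
  naturality x y f := by
    ext t
    induction t using Tensor.ind with
    | h b s m =>
      induction s using Tensor.ind with
      | h c l n => rfl

/-- The left unit 2-cell `[m, h] ↦ m · h`. -/
def leftUnitHom (M : Distributor A B) : comp (id A) M ⟶ M where
  app x := ↾ Tensor.lift (fun a m (h : a ⟶ x.2) => (M.row x.1).map h m) (by
    intro a a' f m h
    refine Eq.trans ?_ (Functor.map_comp_apply (M.row x.1) f h m)
    exact congrArg (fun k => (M.row x.1).map k m) (congrArg (f ≫ ·) (Category.comp_id h)))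
  naturality x y f := by
    ext t
    induction t using Tensor.ind with
    | h a m h =>
      refine (map_apply_eq M _ _ _ _ m).trans (Eq.trans ?_ (map_apply_eq M _ _ f.1 f.2 m).symm)
      refine congrArg₂ (fun k l => M.map (k ×ₘ l) m) ?_ ?_
      · exact (Category.comp_id f.1).trans (Category.id_comp f.1).symm
      · change 𝟙 a ≫ (𝟙 a ≫ (show a ⟶ x.2 from h) ≫ f.2) = (show a ⟶ x.2 from h) ≫ f.2
        simp

/-- The inverse left unit 2-cell `m ↦ [m, 𝟙]`. -/
def leftUnitInv (M : Distributor A B) : M ⟶ comp (id A) M where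
  app x := ↾ fun m => Tensor.mk (X := M.row x.1) (Y := (id A).col x.2) x.2 m (𝟙 x.2)
  naturality x y f := by
    ext m
    refine Eq.trans ?_ (Eq.trans (Tensor.glue (X := M.row y.1) (Y := (id A).col y.2) f.2
      (M.map (f.1 ×ₘ 𝟙 x.2) m) (𝟙 y.2)).symm ?_)
    · refine congrArg (fun k => Tensor.mk (X := M.row y.1) (Y := (id A).col y.2) y.2 k (𝟙 y.2)) ?_
      refine Eq.trans ?_ (map_apply_eq M _ _ _ _ m).symm
      exact congrArg₂ (fun k l => M.map (k ×ₘ l) m) (Category.comp_id f.1).symm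
        (Category.id_comp f.2).symm
    · refine congrArg (fun k => Tensor.mk (X := M.row y.1) (Y := (id A).col y.2) x.2
        (M.map (f.1 ×ₘ 𝟙 x.2) m) k) ?_
      change f.2 ≫ 𝟙 y.2 ≫ 𝟙 y.2 = 𝟙 x.2 ≫ 𝟙 x.2 ≫ f.2
      simp

/-- The right unit 2-cell `[h, m] ↦ h · m`. -/
def rightUnitHom (M : Distributor A B) : comp M (id B) ⟶ M where
  app x := ↾ Tensor.lift (fun b (h : x.1.unop ⟶ b) m => (M.col x.2).map h.op m) (by
    intro b b' f h m
    refine (Functor.map_comp_apply (M.col x.2) f.op h.op m).symm.trans ?_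
    exact congrArg (fun k : x.1.unop ⟶ b' => (M.col x.2).map k.op m) (Category.id_comp (h ≫ f)).symm)
  naturality x y f := by
    ext t
    induction t using Tensor.ind with
    | h a h m => 
      refine (map_apply_eq M _ _ _ _ m).trans (Eq.trans ?_ (map_apply_eq M _ _ f.1 f.2 m).symm)
      refine congrArg₂ (fun k l => M.map (k ×ₘ l) m) ?_ ?_
      · change 𝟙 (op a) ≫ (f.1.unop ≫ (show x.1.unop ⟶ a from h) ≫ 𝟙 a).op =
          (show x.1.unop ⟶ a from h).op ≫ f.1
        rw [Category.comp_id (show x.1.unop ⟶ a from h), op_comp, Category.id_comp]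
        rfl
      · exact (Category.comp_id f.2).trans (Category.id_comp f.2).symm

/-- The inverse right unit 2-cell `m ↦ [𝟙, m]`. -/
def rightUnitInv (M : Distributor A B) : M ⟶ comp M (id B) where
  app x := ↾ fun m => Tensor.mk (X := (id B).row x.1) (Y := M.col x.2) x.1.unop (𝟙 x.1.unop) m
  naturality x y f := by
    ext m
    refine Eq.trans ?_ (Eq.trans (Tensor.glue (X := (id B).row y.1) (Y := M.col y.2) f.1.unop
      (𝟙 y.1.unop) (M.map (𝟙 x.1 ×ₘ f.2) m)) ?_)
    · refine congrArg (fun k => Tensor.mk (X := (id B).row y.1) (Y := M.col y.2) y.1.unop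
        (𝟙 y.1.unop) k) ?_
      refine Eq.trans ?_ (map_apply_eq M _ _ _ _ m).symm
      exact congrArg₂ (fun k l => M.map (k ×ₘ l) m) (Category.id_comp f.1).symm
        (Category.comp_id f.2).symm
    · refine congrArg (fun k => Tensor.mk (X := (id B).row y.1) (Y := M.col y.2) x.1.unop
        k (M.map (𝟙 x.1 ×ₘ f.2) m)) ?_
      change 𝟙 y.1.unop ≫ 𝟙 y.1.unop ≫ f.1.unop = f.1.unop ≫ 𝟙 x.1.unop ≫ 𝟙 x.1.unop
      simp

/-- Associativity. -/
def assoc (M : Distributor A B) (N : Distributor B C) (L : Distributor C D) :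
    comp (comp M N) L ≅ comp M (comp N L) where
  hom := assocHom M N L
  inv := assocInv M N L
  hom_inv_id := by
    ext x t
    induction t using Tensor.ind with
    | h c l s =>
      induction s using Tensor.ind with
      | h b n m => rfl
  inv_hom_id := by
    ext x t
    induction t using Tensor.ind with
    | h b s m =>
      induction s using Tensor.ind with
      | h c l n => rfl

/-- Left unitality. -/
def leftUnit (M : Distributor A B) : comp (id A) M ≅ M where
  hom := leftUnitHom M
  inv := leftUnitInv M
  hom_inv_id := by
    ext x t
    induction t using Tensor.ind with
    | h a m h =>
      refine (Tensor.glue (X := M.row x.1) (Y := (id A).col x.2) h m (𝟙 x.2)).symm.trans ?_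
      refine congrArg (fun k => Tensor.mk (X := M.row x.1) (Y := (id A).col x.2) a m k) ?_
      change (show a ⟶ x.2 from h) ≫ 𝟙 x.2 ≫ 𝟙 x.2 = h
      rw [Category.comp_id]
      exact Category.comp_id (show a ⟶ x.2 from h)
  inv_hom_id := by
    ext x m
    exact (M.row x.1).map_id_apply x.2 m

/-- Right unitality. -/
def rightUnit (M : Distributor A B) : comp M (id B) ≅ M where
  hom := rightUnitHom M
  inv := rightUnitInv M
  hom_inv_id := by
    ext x t
    induction t using Tensor.ind with
    | h b h m =>
      refine (Tensor.glue (X := (id B).row x.1) (Y := M.col x.2) (show x.1.unop ⟶ b from h)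
        (𝟙 x.1.unop) m).trans ?_
      refine congrArg (fun k => Tensor.mk (X := (id B).row x.1) (Y := M.col x.2) b k m) ?_
      change 𝟙 x.1.unop ≫ 𝟙 x.1.unop ≫ (show x.1.unop ⟶ b from h) = h
      rw [Category.id_comp]
      exact Category.id_comp (show x.1.unop ⟶ b from h)
  inv_hom_id := by
    ext x m
    exact (M.col x.2).map_id_apply x.1 m

end Distributor
end Distributors

/-- The bicategory of small categories and distributors has the small categories as objects. -/
structure DIST : Type (u + 1) where
  of ::
  /-- The underlying small category. -/
  cat : Cat.{u, u}

open Distributor in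
instance : Bicategory DIST.{u} where
  Hom A B := Distributor A.cat B.cat
  id A := Distributor.id A.cat
  comp M N := Distributor.comp M N
  homCategory _ _ := Functor.category
  whiskerLeft M _ _ ν := hcomp (𝟙 M) ν
  whiskerRight μ N := hcomp μ (𝟙 N)
  associator := assoc
  leftUnitor := leftUnit
  rightUnitor := rightUnit
  whiskerLeft_id := by
    intros; apply comp_hom_ext; intros; rfl
  whiskerLeft_comp := by
    intros; apply comp_hom_ext; intros; rfl
  id_whiskerLeft {A B M M'} η := by
    apply comp_hom_ext; intro b a a' m h
    have e : ∀ k : a' ⟶ a, Tensor.mk (X := M'.row b) (Y := (Distributor.id A.cat).col a) a'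
        (η.app (b, a') m) k =
        Tensor.mk (X := M'.row b) (Y := (Distributor.id A.cat).col a) a
          (η.app (b, a) ((M.row b).map k m)) (𝟙 a) := by
      intro k
      refine Eq.trans ?_ (Eq.trans (Tensor.glue (X := M'.row b)
        (Y := (Distributor.id A.cat).col a) k (η.app (b, a') m) (𝟙 a)) ?_)
      · refine congrArg (fun l => Tensor.mk (X := M'.row b)
          (Y := (Distributor.id A.cat).col a) a' (η.app (b, a') m) l) ?_
        change k = k ≫ 𝟙 a ≫ 𝟙 a
        simp
      · exact congrArg (fun l => Tensor.mk (X := M'.row b)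
          (Y := (Distributor.id A.cat).col a) a l (𝟙 a))
          (NatTrans.naturality_apply (rowHom η b) k m).symm
    exact e h
  comp_whiskerLeft M N L L' η := by
    apply comp_hom_ext; intro d a b l m
    induction m using Tensor.ind with
    | h c n m => rfl
  id_whiskerRight := by
    intros; apply comp_hom_ext; intros; rfl
  comp_whiskerRight := by
    intros; apply comp_hom_ext; intros; rfl
  whiskerRight_id {A B M M'} η := by
    apply comp_hom_ext; intro b a b' h m
    have e : ∀ k : b.unop ⟶ b', Tensor.mk (X := (Distributor.id B.cat).row b) (Y := M'.col a) b'
        k (η.app (op b', a) m) =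
        Tensor.mk (X := (Distributor.id B.cat).row b) (Y := M'.col a) b.unop (𝟙 b.unop)
          (η.app (b, a) ((M.col a).map k.op m)) := by
      intro k
      refine Eq.trans ?_ (Eq.trans (Tensor.glue (X := (Distributor.id B.cat).row b)
        (Y := M'.col a) k (𝟙 b.unop) (η.app (op b', a) m)).symm ?_)
      · refine congrArg (fun l => Tensor.mk (X := (Distributor.id B.cat).row b)
          (Y := M'.col a) b' l (η.app (op b', a) m)) ?_
        change k = 𝟙 b.unop ≫ 𝟙 b.unop ≫ k
        simp
      · exact congrArg (fun l => Tensor.mk (X := (Distributor.id B.cat).row b)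
          (Y := M'.col a) b.unop (𝟙 b.unop) l)
          (NatTrans.naturality_apply (colHom η a) k.op m).symm
    exact e h
  whiskerRight_comp η N L := by
    apply comp_hom_ext; intro d a b l m
    induction l using Tensor.ind with
    | h c n m => rfl
  whisker_assoc M N N' η L := by
    apply comp_hom_ext; intro d a b l m
    induction m using Tensor.ind with
    | h c n m => rfl
  whisker_exchange := by
    intros; apply comp_hom_ext; intros; rfl
  pentagon M N L K := by
    apply comp_hom_ext; intro d a b l m
    induction m using Tensor.ind with
    | h c n m =>
      induction m using Tensor.ind with
      | h c n m => rfl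
  triangle M N := by
    apply comp_hom_ext; intro d a b l m
    induction m using Tensor.ind with
    | h c h m => exact (Tensor.glue (X := N.row d) (Y := M.col a) (show b ⟶ c from h) l m).symm


/-! ### Pointed objects of a bicategory -/

section LaxCoslice

universe w v z

/-- An object of `B` together with a 1-cell from `I`. -/
structure LaxCoslice (B : Type z) [Bicategory.{w, v} B] (I : B) where
  /-- The underlying object. -/
  base : B
  /-- The 1-cell. -/
  pt : I ⟶ base

namespace LaxCoslice

section

variable {B : Type z} [Bicategory.{w, v} B] {I : B}

/-- A morphism `R → S` is a 1-cell `M` together with a 2-cell `M ∘ R ⇒ S`. -/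
structure Hom (R S : LaxCoslice B I) where
  /-- The underlying 1-cell. -/
  base : R.base ⟶ S.base
  /-- The 2-cell. -/
  cell : R.pt ≫ base ⟶ S.pt

/-- A 2-cell `(M, α) ⇒ (N, β)` is a 2-cell `M ⇒ N` compatible with `α` and `β`. -/
structure Hom₂ {R S : LaxCoslice B I} (f g : Hom R S) where
  /-- The underlying 2-cell. -/
  base : f.base ⟶ g.base
  w : R.pt ◁ base ≫ g.cell = f.cell

theorem Hom₂.ext' {R S : LaxCoslice B I} {f g : Hom R S} {η θ : Hom₂ f g}
    (h : η.base = θ.base) : η = θ := by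
  cases η; cases θ; cases h; rfl

instance : CategoryStruct (LaxCoslice B I) where
  Hom := Hom
  id R := ⟨𝟙 R.base, (ρ_ R.pt).hom⟩
  comp {R _ _} f g := ⟨f.base ≫ g.base, (α_ R.pt f.base g.base).inv ≫ f.cell ▷ g.base ≫ g.cell⟩

instance (R S : LaxCoslice B I) : Category (R ⟶ S) where
  Hom f g := Hom₂ f g
  id f := ⟨𝟙 f.base, by simp⟩
  comp η θ := ⟨η.base ≫ θ.base, by rw [whiskerLeft_comp, Category.assoc, θ.w, η.w]⟩
  id_comp _ := Hom₂.ext' (Category.id_comp _)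
  comp_id _ := Hom₂.ext' (Category.comp_id _)
  assoc _ _ _ := Hom₂.ext' (Category.assoc _ _ _)

theorem hom₂_ext {R S : LaxCoslice B I} {f g : R ⟶ S} {η θ : f ⟶ g}
    (h : Hom₂.base η = Hom₂.base θ) : η = θ := Hom₂.ext' h

/-- An invertible 2-cell of `B` compatible with the cells is an invertible 2-cell. -/
def mkIso {R S : LaxCoslice B I} {f g : R ⟶ S} (e : Hom.base f ≅ Hom.base g)
    (h : R.pt ◁ e.hom ≫ Hom.cell g = Hom.cell f) : f ≅ g where
  hom := ⟨e.hom, h⟩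
  inv := ⟨e.inv, by rw [← h, whiskerLeft_inv_hom_assoc]⟩
  hom_inv_id := hom₂_ext e.hom_inv_id
  inv_hom_id := hom₂_ext e.inv_hom_id

instance : Bicategory (LaxCoslice B I) where
  toCategoryStruct := inferInstance
  homCategory := inferInstance
  whiskerLeft {R _ _} f g h η := ⟨Hom.base f ◁ Hom₂.base η, by
    change R.pt ◁ (Hom.base f ◁ Hom₂.base η) ≫
      ((α_ R.pt (Hom.base f) (Hom.base h)).inv ≫ Hom.cell f ▷ Hom.base h ≫ Hom.cell h) =
      (α_ R.pt (Hom.base f) (Hom.base g)).inv ≫ Hom.cell f ▷ Hom.base g ≫ Hom.cell g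
    rw [← Hom₂.w η, ← whisker_exchange_assoc]
    simp⟩
  whiskerRight {R _ _ f g} η h := ⟨Hom₂.base η ▷ Hom.base h, by
    change R.pt ◁ (Hom₂.base η ▷ Hom.base h) ≫
      ((α_ R.pt (Hom.base g) (Hom.base h)).inv ≫ Hom.cell g ▷ Hom.base h ≫ Hom.cell h) =
      (α_ R.pt (Hom.base f) (Hom.base h)).inv ≫ Hom.cell f ▷ Hom.base h ≫ Hom.cell h
    rw [← Hom₂.w η]
    simp⟩
  associator {R S _ _} f g h := mkIso (α_ (Hom.base f) (Hom.base g) (Hom.base h)) (by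
    change R.pt ◁ (α_ (Hom.base f) (Hom.base g) (Hom.base h)).hom ≫
      ((α_ R.pt (Hom.base f) (Hom.base g ≫ Hom.base h)).inv ≫
        Hom.cell f ▷ (Hom.base g ≫ Hom.base h) ≫
        ((α_ S.pt (Hom.base g) (Hom.base h)).inv ≫ Hom.cell g ▷ Hom.base h ≫ Hom.cell h)) =
      (α_ R.pt (Hom.base f ≫ Hom.base g) (Hom.base h)).inv ≫
        ((α_ R.pt (Hom.base f) (Hom.base g)).inv ≫ Hom.cell f ▷ Hom.base g ≫ Hom.cell g) ▷
          Hom.base h ≫ Hom.cell h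
    simp)
  leftUnitor {R _} f := mkIso (λ_ (Hom.base f)) (by
    change R.pt ◁ (λ_ (Hom.base f)).hom ≫ Hom.cell f =
      (α_ R.pt (𝟙 R.base) (Hom.base f)).inv ≫ (ρ_ R.pt).hom ▷ Hom.base f ≫ Hom.cell f
    simp)
  rightUnitor {R S} f := mkIso (ρ_ (Hom.base f)) (by
    change R.pt ◁ (ρ_ (Hom.base f)).hom ≫ Hom.cell f =
      (α_ R.pt (Hom.base f) (𝟙 S.base)).inv ≫ Hom.cell f ▷ 𝟙 S.base ≫ (ρ_ S.pt).hom
    simp)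
  whiskerLeft_id _ _ := hom₂_ext (whiskerLeft_id _ _)
  whiskerLeft_comp _ _ _ _ _ _ := hom₂_ext (whiskerLeft_comp _ _ _)
  id_whiskerLeft _ := hom₂_ext (id_whiskerLeft _)
  comp_whiskerLeft _ _ _ _ _ := hom₂_ext (comp_whiskerLeft _ _ _)
  id_whiskerRight _ _ := hom₂_ext (id_whiskerRight _ _)
  comp_whiskerRight _ _ _ := hom₂_ext (comp_whiskerRight _ _ _)
  whiskerRight_id _ := hom₂_ext (whiskerRight_id _)
  whiskerRight_comp _ _ _ := hom₂_ext (whiskerRight_comp _ _ _)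
  whisker_assoc _ _ _ _ _ := hom₂_ext (whisker_assoc _ _ _)
  whisker_exchange _ _ := hom₂_ext (whisker_exchange _ _)
  pentagon _ _ _ _ := hom₂_ext (pentagon _ _ _ _)
  triangle _ _ := hom₂_ext (triangle _ _)

end

/-- The projection onto the underlying objects, 1-cells and 2-cells. -/
def proj (B : Type z) [Bicategory.{w, v} B] (I : B) : StrictPseudofunctor (LaxCoslice B I) B where
  obj R := R.base
  map f := Hom.base f
  map₂ η := Hom₂.base η
  mapId R := Iso.refl _
  mapComp f g := Iso.refl _
  map₂_whisker_left f _ _ η :=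
    ((Category.id_comp _).trans (Category.comp_id (Hom.base f ◁ Hom₂.base η))).symm
  map₂_whisker_right η h :=
    ((Category.id_comp _).trans (Category.comp_id (Hom₂.base η ▷ Hom.base h))).symm
  map₂_associator f g h := by
    change (α_ (Hom.base f) (Hom.base g) (Hom.base h)).hom = 𝟙 _ ≫ 𝟙 _ ▷ _ ≫
      (α_ (Hom.base f) (Hom.base g) (Hom.base h)).hom ≫ _ ◁ 𝟙 _ ≫ 𝟙 _
    simp
  map₂_left_unitor f := by
    change (λ_ (Hom.base f)).hom = 𝟙 _ ≫ 𝟙 _ ▷ _ ≫ (λ_ (Hom.base f)).hom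
    simp
  map₂_right_unitor f := by
    change (ρ_ (Hom.base f)).hom = 𝟙 _ ≫ _ ◁ 𝟙 _ ≫ (ρ_ (Hom.base f)).hom
    simp

end LaxCoslice

end LaxCoslice

/-! ### The bifibration of presheaves over distributors -/

section Presheaves

/-- The terminal category `1`, as an object of `DIST`. -/
def DIST.one : DIST.{u} := ⟨Cat.of (Discrete PUnit.{u + 1})⟩

/-- The bicategory `PSH`: its objects are distributors `R : 1 ⇸ A`, and its
morphisms `R → S` are pairs of a distributor `M : A ⇸ B` and a 2-cell `M ∘ R ⇒ S`. -/
abbrev PSH : Type (u + 1) := LaxCoslice DIST.{u} DIST.one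

/-- The projection `p : PSH → DIST`. -/
abbrev PSH.p : StrictPseudofunctor PSH.{u} DIST.{u} := LaxCoslice.proj DIST.{u} DIST.one

/-- A contravariant presheaf on `A`, as a distributor `1 ⇸ A`. -/
def presheafDist (A : DIST.{u}) : ((A.cat)ᵒᵖ ⥤ Type u) ⥤ (DIST.one ⟶ A) :=
  (Functor.whiskeringLeft ((A.cat)ᵒᵖ × Discrete PUnit.{u + 1}) (A.cat)ᵒᵖ (Type u)).obj
    (CategoryTheory.Prod.fst _ _)

/-- The object of `PSH` given by a presheaf `R` on `A`. -/
def PSH.of (A : DIST.{u}) (R : (A.cat)ᵒᵖ ⥤ Type u) : PSH.{u} := ⟨A, (presheafDist A).obj R⟩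

/-- `∃_M R = b ↦ ∫^a M(b, a) × R(a)`. -/
def existsAlong {A B : DIST.{u}} (M : A ⟶ B) : ((A.cat)ᵒᵖ ⥤ Type u) ⥤ ((B.cat)ᵒᵖ ⥤ Type u) where
  obj R :=
    { obj := fun b => Tensor (Distributor.row M b) R
      map := fun g => ↾ Tensor.map (Distributor.rowMap M g) (𝟙 R)
      map_id := by intro b; ext t; simp
      map_comp := by
        intro b b' b'' g g'; ext t
        simpa using Tensor.map_comp (Distributor.rowMap M g) (Distributor.rowMap M g') (𝟙 R) (𝟙 R) t }
  map α :=
    { app := fun b => ↾ Tensor.map (𝟙 _) α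
      naturality := by
        intro b b' g; ext t
        induction t using Tensor.ind with
        | h a m r => rfl }
  map_id R := by ext b t; simp
  map_comp α β := by
    ext b t
    simpa using Tensor.map_comp (𝟙 (Distributor.row M b)) (𝟙 _) α β t

/-- `∀_M S = a ↦ ∫_b (M(b, a) → S(b))`. -/
def forallAlong {A B : DIST.{u}} (M : A ⟶ B) : ((B.cat)ᵒᵖ ⥤ Type u) ⥤ ((A.cat)ᵒᵖ ⥤ Type u) where
  obj S :=
    { obj := fun a => Cotensor (Distributor.col M a.unop) S
      map := fun f => ↾ Cotensor.map (Distributor.colMap M f.unop) (𝟙 S)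
      map_id := by intro a; ext t; simp
      map_comp := by
        intro a a' a'' f f'; ext t
        simpa using Cotensor.map_comp (Distributor.colMap M f.unop) (Distributor.colMap M f'.unop)
          (𝟙 S) (𝟙 S) t }
  map α :=
    { app := fun a => ↾ Cotensor.map (𝟙 _) α
      naturality := by intro a a' g; rfl }
  map_id S := by ext a t; simp
  map_comp α β := by
    ext a t
    simpa using Cotensor.map_comp (𝟙 (Distributor.col M a.unop)) (𝟙 _) α β t

end Presheaves

/-! ### Lawvere's presheaf hyperdoctrine -/

section Hyperdoctrine

variable {A B : Cat.{u, u}}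

/-- Substitution `F* S = S ∘ F`. -/
def substPsh (F : A ⟶ B) : ((B : Type u)ᵒᵖ ⥤ Type u) ⥤ ((A : Type u)ᵒᵖ ⥤ Type u) :=
  (Functor.whiskeringLeft (A : Type u)ᵒᵖ (B : Type u)ᵒᵖ (Type u)).obj F.toFunctor.op

/-- `Σ_F R = b ↦ ∫^a hom_B(b, F a) × R(a)`. -/
def sigmaPsh (F : A ⟶ B) : ((A : Type u)ᵒᵖ ⥤ Type u) ⥤ ((B : Type u)ᵒᵖ ⥤ Type u) where
  obj R :=
    { obj := fun b => Tensor (F.toFunctor ⋙ coyoneda.obj b) R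
      map := fun g => ↾ Tensor.map (Functor.whiskerLeft F.toFunctor (coyoneda.map g)) (𝟙 R)
      map_id := by intro b; ext t; simp
      map_comp := by
        intro b b' b'' g g'; ext t
        simpa using Tensor.map_comp (Functor.whiskerLeft F.toFunctor (coyoneda.map g))
          (Functor.whiskerLeft F.toFunctor (coyoneda.map g')) (𝟙 R) (𝟙 R) t }
  map α :=
    { app := fun b => ↾ Tensor.map (𝟙 _) α
      naturality := by
        intro b b' g; ext t
        induction t using Tensor.ind with
        | h a m r => rfl }
  map_id R := by ext b t; simp
  map_comp α β := by
    ext b t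
    simpa using Tensor.map_comp (𝟙 (F.toFunctor ⋙ coyoneda.obj b)) (𝟙 _) α β t

/-- `Π_F R = b ↦ ∫_a (hom_B(F a, b) → R(a))`. -/
def piPsh (F : A ⟶ B) : ((A : Type u)ᵒᵖ ⥤ Type u) ⥤ ((B : Type u)ᵒᵖ ⥤ Type u) where
  obj R :=
    { obj := fun b => Cotensor (F.toFunctor.op ⋙ yoneda.obj b.unop) R
      map := fun g => ↾ Cotensor.map (Functor.whiskerLeft F.toFunctor.op (yoneda.map g.unop)) (𝟙 R)
      map_id := by intro b; ext t; simp
      map_comp := by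
        intro b b' b'' g g'; ext t
        simpa using Cotensor.map_comp (Functor.whiskerLeft F.toFunctor.op (yoneda.map g.unop))
          (Functor.whiskerLeft F.toFunctor.op (yoneda.map g'.unop)) (𝟙 R) (𝟙 R) t }
  map α :=
    { app := fun b => ↾ Cotensor.map (𝟙 _) α
      naturality := by intro b b' g; rfl }
  map_id R := by ext b t; simp
  map_comp α β := by
    ext b t
    simpa using Cotensor.map_comp (𝟙 (F.toFunctor.op ⋙ yoneda.obj b.unop)) (𝟙 _) α β t

end Hyperdoctrine

/-! ### The embeddings of `Cat` and of its opposite into `DIST` -/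

section Embeddings

open scoped CategoryTheory.Prod

/-- The distributor `F⁺ = (b, a) ↦ hom_B(b, F a) : A ⇸ B`. -/
def plusDist {A B : Cat.{u, u}} (F : A ⟶ B) : DIST.of A ⟶ DIST.of B where
  obj x := x.1.unop ⟶ F.toFunctor.obj x.2
  map f := ↾ fun h => f.1.unop ≫ h ≫ F.toFunctor.map f.2
  map_id := by intro; ext; simp
  map_comp := by intros; ext; simp

/-- The distributor `F⁻ = (a, b) ↦ hom_B(F a, b) : B ⇸ A`. -/
def minusDist {A B : Cat.{u, u}} (F : A ⟶ B) : DIST.of B ⟶ DIST.of A where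
  obj x := F.toFunctor.obj x.1.unop ⟶ x.2
  map f := ↾ fun h => F.toFunctor.map f.1.unop ≫ h ≫ f.2
  map_id := by intro; ext; simp
  map_comp := by intros; ext; simp

/-- `(𝟙 A)⁺` is the identity distributor. -/
def plusId (A : Cat.{u, u}) : plusDist (𝟙 A) ≅ 𝟙 (DIST.of A) := Iso.refl _

/-- `(𝟙 A)⁻` is the identity distributor. -/
def minusId (A : Cat.{u, u}) : minusDist (𝟙 A) ≅ 𝟙 (DIST.of A) := Iso.refl _

/-- The element `[k, l]` of `(G⁺ ∘ F⁺)(c, a)`. -/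
def plusMk {A B C : Cat.{u, u}} (F : A ⟶ B) (G : B ⟶ C) (c : (C : Type u)ᵒᵖ) (a : A) (b : B)
    (k : c.unop ⟶ G.toFunctor.obj b) (l : b ⟶ F.toFunctor.obj a) :
    Tensor (Distributor.row (plusDist G) c) (Distributor.col (plusDist F) a) :=
  Tensor.mk b k l

theorem plusMk_glue {A B C : Cat.{u, u}} (F : A ⟶ B) (G : B ⟶ C) (c : (C : Type u)ᵒᵖ) (a : A)
    {b b' : B} (f : b ⟶ b') (k : c.unop ⟶ G.toFunctor.obj b) (l : b' ⟶ F.toFunctor.obj a) :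
    plusMk F G c a b k (f ≫ l) = plusMk F G c a b' (k ≫ G.toFunctor.map f) l := by
  have h := Tensor.glue (X := Distributor.row (plusDist G) c)
    (Y := Distributor.col (plusDist F) a) f k l
  have h₁ : (Distributor.row (plusDist G) c).map f k = k ≫ G.toFunctor.map f :=
    Category.id_comp (k ≫ G.toFunctor.map f)
  have h₂ : (Distributor.col (plusDist F) a).map f.op l = f ≫ l := by
    change f ≫ l ≫ F.toFunctor.map (𝟙 a) = f ≫ l
    simp
  rw [h₁, h₂] at h
  exact h

/-- `(F ≫ G)⁺ ≅ F⁺ ≫ G⁺`, sending `h : c ⟶ G (F a)` to `[h, 𝟙]`, with inverse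
`[k, l] ↦ k ≫ G l`. -/
def plusComp {A B C : Cat.{u, u}} (F : A ⟶ B) (G : B ⟶ C) :
    plusDist (F ≫ G) ≅ plusDist F ≫ plusDist G where
  hom :=
    { app := fun x => ↾ fun h => plusMk F G x.1 x.2 (F.toFunctor.obj x.2) h
        (𝟙 (F.toFunctor.obj x.2))
      naturality := by
        intro x y f
        ext h
        have e := plusMk_glue F G y.1 y.2 (F.toFunctor.map f.2) (f.1.unop ≫ h) (𝟙 _)
        refine Eq.trans ?_ (e.symm.trans ?_)
        · refine congrArg (fun k => plusMk F G y.1 y.2 (F.toFunctor.obj y.2) k (𝟙 _)) ?_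
          exact (Category.assoc _ _ _).symm
        · refine congrArg₂ (fun k l => plusMk F G y.1 y.2 (F.toFunctor.obj x.2) k l) ?_ ?_
          · change f.1.unop ≫ h = f.1.unop ≫ h ≫ G.toFunctor.map (𝟙 _)
            rw [G.toFunctor.map_id]
            exact congrArg (f.1.unop ≫ ·) (Category.comp_id h).symm
          · change F.toFunctor.map f.2 ≫ 𝟙 _ = 𝟙 _ ≫ 𝟙 _ ≫ F.toFunctor.map f.2
            simp }
  inv :=
    { app := fun x => ↾ Tensor.lift (X := Distributor.row (plusDist G) x.1)
        (Y := Distributor.col (plusDist F) x.2)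
        (fun b (k : x.1.unop ⟶ G.toFunctor.obj b) (l : b ⟶ F.toFunctor.obj x.2) =>
          k ≫ G.toFunctor.map l)
        (by
          intro b b' f k l
          have e : ∀ (k : x.1.unop ⟶ G.toFunctor.obj b) (l : b' ⟶ F.toFunctor.obj x.2),
              k ≫ G.toFunctor.map (f ≫ l ≫ F.toFunctor.map (𝟙 x.2)) =
              (𝟙 x.1.unop ≫ k ≫ G.toFunctor.map f) ≫ G.toFunctor.map l := by
            intro k l; simp
          exact e k l)
      naturality := by
        intro x y f
        ext t
        induction t using Tensor.ind with
        | h b k l =>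
          have e : ∀ (k : x.1.unop ⟶ G.toFunctor.obj b) (l : b ⟶ F.toFunctor.obj x.2),
              (f.1.unop ≫ k ≫ G.toFunctor.map (𝟙 b)) ≫
              G.toFunctor.map (𝟙 b ≫ l ≫ F.toFunctor.map f.2) =
              f.1.unop ≫ (k ≫ G.toFunctor.map l) ≫ G.toFunctor.map (F.toFunctor.map f.2) := by
            intro k l; simp
          exact e k l }
  hom_inv_id := by
    apply Distributor.hom_ext
    intro c a h
    change h ≫ G.toFunctor.map (𝟙 (F.toFunctor.obj a)) = h
    rw [G.toFunctor.map_id]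
    exact Category.comp_id h
  inv_hom_id := by
    apply Distributor.comp_hom_ext
    intro c a b k l
    refine (plusMk_glue F G c a l k (𝟙 _)).symm.trans ?_
    exact congrArg (fun t => plusMk F G c a b k t) (Category.comp_id l)

/-- The element `[k, l]` of `(G⁻ ∘ F⁻)(c, a)`. -/
def minusMk {A B C : Cat.{u, u}} (F : B ⟶ A) (G : C ⟶ B) (c : (C : Type u)ᵒᵖ) (a : A) (b : B)
    (k : G.toFunctor.obj c.unop ⟶ b) (l : F.toFunctor.obj b ⟶ a) :
    Tensor (Distributor.row (minusDist G) c) (Distributor.col (minusDist F) a) :=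
  Tensor.mk b k l

theorem minusMk_glue {A B C : Cat.{u, u}} (F : B ⟶ A) (G : C ⟶ B) (c : (C : Type u)ᵒᵖ) (a : A)
    {b b' : B} (f : b ⟶ b') (k : G.toFunctor.obj c.unop ⟶ b) (l : F.toFunctor.obj b' ⟶ a) :
    minusMk F G c a b k (F.toFunctor.map f ≫ l) = minusMk F G c a b' (k ≫ f) l := by
  have h := Tensor.glue (X := Distributor.row (minusDist G) c)
    (Y := Distributor.col (minusDist F) a) f k l
  have h₁ : (Distributor.row (minusDist G) c).map f k = k ≫ f := by
    change G.toFunctor.map (𝟙 c.unop) ≫ k ≫ f = k ≫ f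
    simp
  have h₂ : (Distributor.col (minusDist F) a).map f.op l = F.toFunctor.map f ≫ l := by
    change F.toFunctor.map f ≫ l ≫ 𝟙 a = F.toFunctor.map f ≫ l
    simp
  rw [h₁, h₂] at h
  exact h

/-- `(G ≫ F)⁻ ≅ F⁻ ≫ G⁻`, sending `h : F (G c) ⟶ a` to `[𝟙, h]`, with inverse
`[k, l] ↦ F k ≫ l`. -/
def minusComp {A B C : Cat.{u, u}} (F : B ⟶ A) (G : C ⟶ B) :
    minusDist (G ≫ F) ≅ minusDist F ≫ minusDist G where
  hom :=
    { app := fun x => ↾ fun h => minusMk F G x.1 x.2 (G.toFunctor.obj x.1.unop)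
        (𝟙 (G.toFunctor.obj x.1.unop)) h
      naturality := by
        intro x y f
        ext h
        have e := minusMk_glue F G y.1 y.2 (G.toFunctor.map f.1.unop) (𝟙 _) (h ≫ f.2)
        refine e.trans ?_
        refine congrArg₂ (fun k l => minusMk F G y.1 y.2 (G.toFunctor.obj x.1.unop) k l) ?_ ?_
        · change 𝟙 _ ≫ G.toFunctor.map f.1.unop = G.toFunctor.map f.1.unop ≫ 𝟙 _ ≫ 𝟙 _
          simp
        · change h ≫ f.2 = F.toFunctor.map (𝟙 _) ≫ h ≫ f.2
          rw [F.toFunctor.map_id]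
          exact (Category.id_comp (h ≫ f.2)).symm }
  inv :=
    { app := fun x => ↾ Tensor.lift (X := Distributor.row (minusDist G) x.1)
        (Y := Distributor.col (minusDist F) x.2)
        (fun b (k : G.toFunctor.obj x.1.unop ⟶ b) (l : F.toFunctor.obj b ⟶ x.2) =>
          F.toFunctor.map k ≫ l)
        (by
          intro b b' f k l
          have e : ∀ (k : G.toFunctor.obj x.1.unop ⟶ b) (l : F.toFunctor.obj b' ⟶ x.2),
              F.toFunctor.map k ≫ (F.toFunctor.map f ≫ l ≫ 𝟙 x.2) =
              F.toFunctor.map (G.toFunctor.map (𝟙 x.1.unop) ≫ k ≫ f) ≫ l := by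
            intro k l; simp
          exact e k l)
      naturality := by
        intro x y f
        ext t
        induction t using Tensor.ind with
        | h b k l =>
          have e : ∀ (k : G.toFunctor.obj x.1.unop ⟶ b) (l : F.toFunctor.obj b ⟶ x.2),
              F.toFunctor.map (G.toFunctor.map f.1.unop ≫ k ≫ 𝟙 b) ≫
              (F.toFunctor.map (𝟙 b) ≫ l ≫ f.2) =
              F.toFunctor.map (G.toFunctor.map f.1.unop) ≫ (F.toFunctor.map k ≫ l) ≫ f.2 := by
            intro k l; simp
          exact e k l }
  hom_inv_id := by
    apply Distributor.hom_ext
    intro c a h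
    change F.toFunctor.map (𝟙 (G.toFunctor.obj c.unop)) ≫ h = h
    rw [F.toFunctor.map_id]
    exact Category.id_comp h
  inv_hom_id := by
    apply Distributor.comp_hom_ext
    intro c a b k l
    refine (minusMk_glue F G c a k (𝟙 _) l).trans ?_
    exact congrArg (fun t => minusMk F G c a b t l) (Category.id_comp k)

theorem plusComp_assoc {A B C D : Cat.{u, u}} (F : A ⟶ B) (G : B ⟶ C) (H : C ⟶ D) :
    (plusComp (F ≫ G) H).hom ≫ (plusComp F G).hom ▷ plusDist H ≫
      (α_ (plusDist F) (plusDist G) (plusDist H)).hom ≫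
      plusDist F ◁ (plusComp G H).inv ≫ (plusComp F (G ≫ H)).inv =
    𝟙 (plusDist (F ≫ G ≫ H)) := by
  apply Distributor.hom_ext
  intro d a h
  have e : ∀ h : d.unop ⟶ H.toFunctor.obj (G.toFunctor.obj (F.toFunctor.obj a)),
      (h ≫ H.toFunctor.map (𝟙 _)) ≫ H.toFunctor.map (G.toFunctor.map (𝟙 _)) = h := by
    intro h; simp
  exact e h

theorem plusComp_left {A B : Cat.{u, u}} (F : A ⟶ B) :
    (plusComp (𝟙 A) F).hom ≫ (plusId A).hom ▷ plusDist F ≫ (λ_ (plusDist F)).hom =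
      𝟙 (plusDist F) := by
  apply Distributor.hom_ext
  intro b a h
  have e : ∀ h : b.unop ⟶ F.toFunctor.obj a, 𝟙 _ ≫ h ≫ F.toFunctor.map (𝟙 a) = h := by
    intro h; simp
  exact e h

theorem plusComp_right {A B : Cat.{u, u}} (F : A ⟶ B) :
    (plusComp F (𝟙 B)).hom ≫ plusDist F ◁ (plusId B).hom ≫ (ρ_ (plusDist F)).hom =
      𝟙 (plusDist F) := by
  apply Distributor.hom_ext
  intro b a h
  have e : ∀ h : b.unop ⟶ F.toFunctor.obj a, h ≫ 𝟙 _ ≫ F.toFunctor.map (𝟙 a) = h := by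
    intro h; simp
  exact e h

theorem minusComp_assoc {A B C D : Cat.{u, u}} (F : B ⟶ A) (G : C ⟶ B) (H : D ⟶ C) :
    (minusComp (G ≫ F) H).hom ≫ (minusComp F G).hom ▷ minusDist H ≫
      (α_ (minusDist F) (minusDist G) (minusDist H)).hom ≫
      minusDist F ◁ (minusComp G H).inv ≫ (minusComp F (H ≫ G)).inv =
    𝟙 (minusDist (H ≫ G ≫ F)) := by
  apply Distributor.hom_ext
  intro d a h
  have e : ∀ h : F.toFunctor.obj (G.toFunctor.obj (H.toFunctor.obj d.unop)) ⟶ a,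
      F.toFunctor.map (G.toFunctor.map (𝟙 _) ≫ 𝟙 _) ≫ h = h := by
    intro h; simp
  exact e h

theorem minusComp_left {A B : Cat.{u, u}} (F : B ⟶ A) :
    (minusComp (𝟙 A) F).hom ≫ (minusId A).hom ▷ minusDist F ≫ (λ_ (minusDist F)).hom =
      𝟙 (minusDist F) := by
  apply Distributor.hom_ext
  intro b a h
  have e : ∀ h : F.toFunctor.obj b.unop ⟶ a,
      F.toFunctor.map (𝟙 b.unop) ≫ 𝟙 _ ≫ h = h := by
    intro h; simp
  exact e h

theorem minusComp_right {A B : Cat.{u, u}} (F : B ⟶ A) :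
    (minusComp F (𝟙 B)).hom ≫ minusDist F ◁ (minusId B).hom ≫ (ρ_ (minusDist F)).hom =
      𝟙 (minusDist F) := by
  apply Distributor.hom_ext
  intro b a h
  have e : ∀ h : F.toFunctor.obj b.unop ⟶ a,
      F.toFunctor.map (𝟙 b.unop) ≫ h ≫ 𝟙 _ = h := by
    intro h; simp
  exact e h

/-- The embedding `F ↦ F⁺` of `Cat` into `DIST`. -/
def embPlus : LocallyDiscrete Cat.{u, u} ⥤ᵖ DIST.{u} :=
  LocallyDiscrete.mkPseudofunctor (fun A => DIST.of A) (fun F => plusDist F)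
    plusId plusComp
    (fun F G H => (plusComp_assoc F G H).trans (eqToHom_refl _ rfl).symm)
    (fun F => (plusComp_left F).trans (eqToHom_refl _ rfl).symm)
    (fun F => (plusComp_right F).trans (eqToHom_refl _ rfl).symm)

/-- The embedding `F ↦ F⁻` of the opposite of `Cat` into `DIST`. -/
def embMinus : LocallyDiscrete (Cat.{u, u})ᵒᵖ ⥤ᵖ DIST.{u} :=
  LocallyDiscrete.mkPseudofunctor (fun A => DIST.of A.unop) (fun F => minusDist F.unop)
    (fun A => minusId A.unop) (fun F G => minusComp F.unop G.unop)
    (fun F G H => (minusComp_assoc F.unop G.unop H.unop).trans (eqToHom_refl _ rfl).symm)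
    (fun F => (minusComp_left F.unop).trans (eqToHom_refl _ rfl).symm)
    (fun F => (minusComp_right F.unop).trans (eqToHom_refl _ rfl).symm)

end Embeddings

/-! ### The bifibrations `Psh⁺` and `Psh⁻` -/

section Psh

/-- An object of `Psh⁺`: a small category with a contravariant presheaf. -/
structure PshPlus : Type (u + 1) where
  /-- The category. -/
  base : Cat.{u, u}
  /-- The presheaf. -/
  pt : (base : Type u)ᵒᵖ ⥤ Type u

/-- A morphism `(A, R) → (B, S)` of `Psh⁺`: a functor `F : A → B` with `R ⇒ S ∘ F`. -/
structure PshPlus.Hom (X Y : PshPlus.{u}) : Type u where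
  /-- The functor. -/
  base : X.base ⟶ Y.base
  /-- The natural transformation. -/
  cell : X.pt ⟶ base.toFunctor.op ⋙ Y.pt

instance : Category PshPlus.{u} where
  Hom := PshPlus.Hom
  id X := ⟨𝟙 X.base, 𝟙 X.pt⟩
  comp f g := ⟨f.base ≫ g.base, f.cell ≫ Functor.whiskerLeft f.base.toFunctor.op g.cell⟩
  id_comp f := congrArg (PshPlus.Hom.mk f.base) (by ext a x; rfl)
  comp_id f := congrArg (PshPlus.Hom.mk f.base) (by ext a x; rfl)
  assoc f g h := congrArg (PshPlus.Hom.mk (f.base ≫ g.base ≫ h.base)) (by ext a x; rfl)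

/-- An object of `Psh⁻`: a small category with a contravariant presheaf. -/
structure PshMinus : Type (u + 1) where
  /-- The category. -/
  base : Cat.{u, u}
  /-- The presheaf. -/
  pt : (base : Type u)ᵒᵖ ⥤ Type u

/-- A morphism `(A, R) → (B, S)` of `Psh⁻`: a functor `F : B → A` with `R ∘ F ⇒ S`. -/
structure PshMinus.Hom (X Y : PshMinus.{u}) : Type u where
  /-- The functor. -/
  base : Y.base ⟶ X.base
  /-- The natural transformation. -/
  cell : base.toFunctor.op ⋙ X.pt ⟶ Y.pt

instance : Category PshMinus.{u} where
  Hom := PshMinus.Hom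
  id X := ⟨𝟙 X.base, 𝟙 X.pt⟩
  comp f g := ⟨g.base ≫ f.base, Functor.whiskerLeft g.base.toFunctor.op f.cell ≫ g.cell⟩
  id_comp f := congrArg (PshMinus.Hom.mk f.base) (by ext a x; rfl)
  comp_id f := congrArg (PshMinus.Hom.mk f.base) (by ext a x; rfl)
  assoc f g h := congrArg (PshMinus.Hom.mk (h.base ≫ g.base ≫ f.base)) (by ext a x; rfl)

/-- The projection `p⁺ : Psh⁺ → Cat`. -/
def pPlus : PshPlus.{u} ⥤ Cat.{u, u} where
  obj X := X.base
  map f := PshPlus.Hom.base f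

/-- The projection `p⁻ : Psh⁻ → Catᵒᵖ`. -/
def pMinus : PshMinus.{u} ⥤ (Cat.{u, u})ᵒᵖ where
  obj X := op X.base
  map f := (PshMinus.Hom.base f).op

/-- The 2-cell `F⁺ ∘ R ⇒ S`, `[h, r] ↦ S(h)(α r)`, associated with `α : R ⇒ S ∘ F`. -/
def plusCell {X Y : PshPlus.{u}} (f : PshPlus.Hom X Y) :
    (presheafDist (DIST.of X.base)).obj X.pt ≫ plusDist f.base ⟶
      (presheafDist (DIST.of Y.base)).obj Y.pt where
  app x := ↾ Tensor.lift
    (X := Distributor.row (plusDist f.base) x.1)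
    (Y := Distributor.col ((presheafDist (DIST.of X.base)).obj X.pt) x.2)
    (fun a (h : x.1.unop ⟶ f.base.toFunctor.obj a) (r : X.pt.obj (op a)) =>
      Y.pt.map h.op (f.cell.app (op a) r))
    (by
      intro a a' k h r
      have e : ∀ (h : x.1.unop ⟶ f.base.toFunctor.obj a) (r : X.pt.obj (op a')),
          Y.pt.map h.op (f.cell.app (op a) (X.pt.map k.op r)) =
            Y.pt.map (𝟙 x.1.unop ≫ h ≫ f.base.toFunctor.map k).op (f.cell.app (op a') r) := by
        intro h r
        rw [NatTrans.naturality_apply]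
        simp
      exact e h r)
  naturality := by
    intro x y g
    ext t
    induction t using Tensor.ind with
    | h a h r =>
      have e : ∀ (h : x.1.unop ⟶ f.base.toFunctor.obj a) (r : X.pt.obj (op a)),
          Y.pt.map (g.1.unop ≫ h ≫ f.base.toFunctor.map (𝟙 a)).op
            (f.cell.app (op a) (X.pt.map (𝟙 (op a)) r)) =
          Y.pt.map g.1 (Y.pt.map h.op (f.cell.app (op a) r)) := by
        intro h r
        simp
      exact e h r

/-- The 2-cell `F⁻ ∘ R ⇒ S`, `[h, r] ↦ α (R(h) r)`, associated with `α : R ∘ F ⇒ S`. -/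
def minusCell {X Y : PshMinus.{u}} (f : PshMinus.Hom X Y) :
    (presheafDist (DIST.of X.base)).obj X.pt ≫ minusDist f.base ⟶
      (presheafDist (DIST.of Y.base)).obj Y.pt where
  app x := ↾ Tensor.lift
    (X := Distributor.row (minusDist f.base) x.1)
    (Y := Distributor.col ((presheafDist (DIST.of X.base)).obj X.pt) x.2)
    (fun a (h : f.base.toFunctor.obj x.1.unop ⟶ a) (r : X.pt.obj (op a)) =>
      f.cell.app x.1 (X.pt.map h.op r))
    (by
      intro a a' k h r
      have e : ∀ (h : f.base.toFunctor.obj x.1.unop ⟶ a) (r : X.pt.obj (op a')),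
          f.cell.app x.1 (X.pt.map h.op (X.pt.map k.op r)) =
            f.cell.app x.1
              (X.pt.map (f.base.toFunctor.map (𝟙 x.1.unop) ≫ h ≫ k).op r) := by
        intro h r
        simp
      exact e h r)
  naturality := by
    intro x y g
    ext t
    induction t using Tensor.ind with
    | h a h r =>
      have e : ∀ (h : f.base.toFunctor.obj x.1.unop ⟶ a) (r : X.pt.obj (op a)),
          f.cell.app y.1 (X.pt.map (f.base.toFunctor.map g.1.unop ≫ h ≫ 𝟙 a).op
            (X.pt.map (𝟙 (op a)) r)) =
          Y.pt.map g.1 (f.cell.app x.1 (X.pt.map h.op r)) := by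
        intro h r
        have := NatTrans.naturality_apply f.cell g.1 (X.pt.map h.op r)
        rw [← this]
        simp
      exact e h r

theorem LaxCoslice.eqToHom_base {B : Type*} [Bicategory B] {I : B} {R S : LaxCoslice B I}
    {f g : R ⟶ S} (h : f = g) :
    LaxCoslice.Hom₂.base (eqToHom h) = eqToHom (congrArg LaxCoslice.Hom.base h) := by
  subst h; rfl

/-- The comparison `Psh⁺ → PSH`, `(F, α) ↦ (F⁺, [h, r] ↦ S(h)(α r))`. -/
def toPSHPlus : LocallyDiscrete PshPlus.{u} ⥤ᵖ PSH.{u} :=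
  LocallyDiscrete.mkPseudofunctor
    (fun X => PSH.of (DIST.of X.base) X.pt)
    (fun f => ⟨plusDist (PshPlus.Hom.base f), plusCell f⟩)
    (fun X => LaxCoslice.mkIso (plusId X.base) (by
      apply Distributor.comp_hom_ext
      intro b s a h r
      rfl))
    (fun {X Y Z} f g => LaxCoslice.mkIso (plusComp (PshPlus.Hom.base f) (PshPlus.Hom.base g)) (by
      apply Distributor.comp_hom_ext
      intro c s a h r
      have e : ∀ (h : c.unop ⟶ (PshPlus.Hom.base g).toFunctor.obj
          ((PshPlus.Hom.base f).toFunctor.obj a)) (r : X.pt.obj (op a)),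
          Z.pt.map h.op ((PshPlus.Hom.cell g).app _
            (Y.pt.map (𝟙 _) ((PshPlus.Hom.cell f).app (op a) r))) =
          Z.pt.map h.op ((PshPlus.Hom.cell g).app _ ((PshPlus.Hom.cell f).app (op a) r)) := by
        intro h r
        rw [Functor.map_id_apply]
      exact e h r))
    (fun F G H => LaxCoslice.hom₂_ext (by
      refine Eq.trans ?_ (LaxCoslice.eqToHom_base _).symm
      exact (plusComp_assoc (PshPlus.Hom.base F) (PshPlus.Hom.base G) (PshPlus.Hom.base H)).trans
        (eqToHom_refl _ rfl).symm))
    (fun F => LaxCoslice.hom₂_ext (by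
      refine Eq.trans ?_ (LaxCoslice.eqToHom_base _).symm
      exact (plusComp_left (PshPlus.Hom.base F)).trans (eqToHom_refl _ rfl).symm))
    (fun F => LaxCoslice.hom₂_ext (by
      refine Eq.trans ?_ (LaxCoslice.eqToHom_base _).symm
      exact (plusComp_right (PshPlus.Hom.base F)).trans (eqToHom_refl _ rfl).symm))

/-- The comparison `Psh⁻ → PSH`, `(F, α) ↦ (F⁻, [h, r] ↦ α (R(h) r))`. -/
def toPSHMinus : LocallyDiscrete PshMinus.{u} ⥤ᵖ PSH.{u} :=
  LocallyDiscrete.mkPseudofunctor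
    (fun X => PSH.of (DIST.of X.base) X.pt)
    (fun f => ⟨minusDist (PshMinus.Hom.base f), minusCell f⟩)
    (fun X => LaxCoslice.mkIso (minusId X.base) (by
      apply Distributor.comp_hom_ext
      intro b s a h r
      rfl))
    (fun {X Y Z} f g => LaxCoslice.mkIso (minusComp (PshMinus.Hom.base f) (PshMinus.Hom.base g)) (by
      apply Distributor.comp_hom_ext
      intro c s a h r
      have e : ∀ (h : (PshMinus.Hom.base f).toFunctor.obj
          ((PshMinus.Hom.base g).toFunctor.obj c.unop) ⟶ a) (r : X.pt.obj (op a)),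
          (PshMinus.Hom.cell g).app _
            (Y.pt.map (𝟙 _) ((PshMinus.Hom.cell f).app _ (X.pt.map h.op r))) =
          (PshMinus.Hom.cell g).app _ ((PshMinus.Hom.cell f).app _ (X.pt.map h.op r)) := by
        intro h r
        rw [Functor.map_id_apply]
      exact e h r))
    (fun F G H => LaxCoslice.hom₂_ext (by
      refine Eq.trans ?_ (LaxCoslice.eqToHom_base _).symm
      exact (minusComp_assoc (PshMinus.Hom.base F) (PshMinus.Hom.base G) (PshMinus.Hom.base H)).trans
        (eqToHom_refl _ rfl).symm))
    (fun F => LaxCoslice.hom₂_ext (by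
      refine Eq.trans ?_ (LaxCoslice.eqToHom_base _).symm
      exact (minusComp_left (PshMinus.Hom.base F)).trans (eqToHom_refl _ rfl).symm))
    (fun F => LaxCoslice.hom₂_ext (by
      refine Eq.trans ?_ (LaxCoslice.eqToHom_base _).symm
      exact (minusComp_right (PshMinus.Hom.base F)).trans (eqToHom_refl _ rfl).symm))

end Psh

/-! ### Bifibrations and pullbacks -/

section Notions

/-- A functor is a bifibration if it is a fibration and an opfibration. -/
def IsBifibration {E B : Type*} [Category* E] [Category* B] (p : E ⥤ B) : Prop :=
  (∀ (S : E) (A : B) (f : A ⟶ p.obj S), ∃ (R : E) (φ : R ⟶ S), p.IsStronglyCartesian f φ) ∧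
  (∀ (R : E) (A : B) (f : p.obj R ⟶ A), ∃ (S : E) (φ : R ⟶ S), p.IsStronglyCocartesian f φ)

variable {E B : Type*} [Bicategory E] [Bicategory B]

/-- `φ : R → S` over `M` exhibits `S` as the pushforward of `R` along `M`: composition with `φ` is a
bijection from the morphisms `S → T` over `N` to the morphisms `R → T` over `N ∘ M`. -/
def IsPush (p : StrictPseudofunctor E B) {R S : E} (φ : R ⟶ S) : Prop :=
  ∀ (T : E) (N : p.obj S ⟶ p.obj T) (χ : R ⟶ T), p.map χ = p.map φ ≫ N →
    ∃! ψ : S ⟶ T, p.map ψ = N ∧ φ ≫ ψ = χ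

/-- `φ : R → S` over `M` exhibits `R` as the pullback of `S` along `M`: composition with `φ` is a
bijection from the morphisms `T → R` over `N` to the morphisms `T → S` over `M ∘ N`. -/
def IsPull (p : StrictPseudofunctor E B) {R S : E} (φ : R ⟶ S) : Prop :=
  ∀ (T : E) (N : p.obj T ⟶ p.obj R) (χ : T ⟶ S), p.map χ = N ≫ p.map φ →
    ∃! ψ : T ⟶ R, p.map ψ = N ∧ ψ ≫ φ = χ

/-- A strict projection of bicategories is a bifibration if every object can be pushed and pulled
along every 1-cell of the base. -/
def IsBifibrationOfBicategories (p : StrictPseudofunctor E B) : Prop :=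
  (∀ (S : E) (A : B) (M : A ⟶ p.obj S), ∃ (R : E) (φ : R ⟶ S),
    p.obj R = A ∧ HEq (p.map φ) M ∧ IsPull p φ) ∧
  (∀ (R : E) (A : B) (M : p.obj R ⟶ A), ∃ (S : E) (φ : R ⟶ S),
    p.obj S = A ∧ HEq (p.map φ) M ∧ IsPush p φ)

end Notions

/-- The square with `T ⋙ p = q ⋙ e` is a pullback in the category of bicategories and
pseudofunctors. -/
structure IsPullbackSquare.{a, b, c, a₁, b₁, c₁, a₂, b₂, c₂, a₃, b₃, c₃, a₄, b₄, c₄}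
    {P : Type c₁} [Bicategory.{a₁, b₁} P] {E : Type c₂} [Bicategory.{a₂, b₂} E]
    {C : Type c₃} [Bicategory.{a₃, b₃} C] {D : Type c₄} [Bicategory.{a₄, b₄} D]
    (T : P ⥤ᵖ E) (q : P ⥤ᵖ C) (p : E ⥤ᵖ D) (e : C ⥤ᵖ D) : Prop where
  comm : T.comp p = q.comp e
  existsUnique_lift : ∀ (X : Type c) [Bicategory.{a, b} X] (U : X ⥤ᵖ E) (V : X ⥤ᵖ C),
    U.comp p = V.comp e → ∃! W : X ⥤ᵖ P, W.comp T = U ∧ W.comp q = V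

end PresheafBifibration

open PresheafBifibration

universe u a b c

/-!
The category `1` has a single morphism, so a distributor `1 ⇸ A` is literally a presheaf `R` on `A`
composed with the projection `Aᵒᵖ × 1 ⟶ Aᵒᵖ`, and `M ∘ R` is, up to the isomorphism `pushIso`, the
presheaf `∃_M R`. A 1-cell of a lax coslice whose 2-cell is invertible is a pushforward
(`isPush_of_isIso`), which gives the pushforwards of `p`. A 1-cell of a lax coslice over `M` is a
pullback as soon as its 2-cell exhibits a right lifting through `M` (`isPull_of_bijective`); for
`∀_M S` the required bijection is the transposition of the adjunction `∃_M ⊣ ∀_M` (`quantAdj`), read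
through `pushIso` (`whiskerRight_pullCell_bijective`).

The adjunctions `Σ_F ⊣ F* ⊣ Π_F` are transported from `∃_{F⁺} ⊣ ∀_{F⁺}` and `∃_{F⁻} ⊣ ∀_{F⁻}`
along the canonical comparison isomorphisms, two of which are Yoneda lemmas. The universal
properties of the unit and of the counit are the cocartesian and cartesian properties in `p⁺` and
`p⁻`.

For the pullback squares, a pseudofunctor into a lax coslice over `I` is the same as a pseudofunctor
`G` into the base together with a lax cone from `I` (`LiftData`): points `I ⟶ G x` and cells over
the 1-cells of the source, subject to conditions but without further data, because 2-cells of the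
coslice are determined by their underlying 2-cells. Similarly a pseudofunctor into a locally
discrete bicategory is determined by its action on objects and 1-cells. So the square over
`e : C ⥤ D` is a pullback once objects of `P` correspond to pairs of an object `c` of `C` and a
1-cell `I ⟶ e c`, and morphisms of `P` to pairs of a morphism of `C` and a cell over it
(`isPullbackSquare_lift`). For `p⁺` and `p⁻` the first is the identification of distributors from
`1` with presheaves, the second is `plusCell_bijective` and `minusCell_bijective`, again Yoneda.
-/

namespace PresheafBifibration

/-! ### Equality of pseudofunctors, and pseudofunctors into locally discrete bicategories -/

section PseudofunctorExt

universe w₁ w₂ w₃ w₄ v₁ v₂ v₃ v₄ u₁ u₂ u₃ u₄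

variable {X : Type u₁} [Bicategory.{w₁, v₁} X] {Y : Type u₂} [Bicategory.{w₂, v₂} Y]
  {Z : Type u₃} [Bicategory.{w₃, v₃} Z] {T : Type u₄} [Bicategory.{w₄, v₄} T]

theorem pseudofunctor_ext_of_prelax {F G : X ⥤ᵖ Y}
    (h : F.toPrelaxFunctor = G.toPrelaxFunctor)
    (hid : ∀ x, HEq (F.mapId x).hom (G.mapId x).hom)
    (hcomp : ∀ {x y z : X} (f : x ⟶ y) (g : y ⟶ z), HEq (F.mapComp f g).hom (G.mapComp f g).hom) :
    F = G := by
  obtain ⟨F, Fi, Fc⟩ := F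
  obtain ⟨G, Gi, Gc⟩ := G
  dsimp only at h
  subst h
  obtain rfl : Fi = Gi := funext fun x => Iso.ext (eq_of_heq (hid x))
  obtain rfl : @Fc = @Gc := by
    funext x y z f g
    exact Iso.ext (eq_of_heq (hcomp f g))
  rfl

theorem prelaxFunctor_ext {F G : PrelaxFunctor X Y} (hobj : ∀ x, F.obj x = G.obj x)
    (hmap : ∀ {x y : X} (f : x ⟶ y), HEq (F.map f) (G.map f))
    (hmap₂ : ∀ {x y : X} {f g : x ⟶ y} (η : f ⟶ g), HEq (F.map₂ η) (G.map₂ η)) : F = G := by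
  obtain ⟨⟨⟨F₀, F₁⟩, F₂⟩⟩ := F
  obtain ⟨⟨⟨G₀, G₁⟩, G₂⟩⟩ := G
  obtain rfl : F₀ = G₀ := funext hobj
  obtain rfl : @F₁ = @G₁ := by
    funext x y f
    exact eq_of_heq (hmap f)
  obtain rfl : @F₂ = @G₂ := by
    funext x y f g η
    exact eq_of_heq (hmap₂ η)
  rfl

theorem pseudofunctor_obj_eq {F G : X ⥤ᵖ Y} (h : F = G) (x : X) : F.obj x = G.obj x := by rw [h]

theorem pseudofunctor_map_heq {F G : X ⥤ᵖ Y} (h : F = G) {x y : X} (f : x ⟶ y) :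
    HEq (F.map f) (G.map f) := by rw [h]

theorem pseudofunctor_comp_assoc (F : X ⥤ᵖ Y) (G : Y ⥤ᵖ Z) (H : Z ⥤ᵖ T) :
    (F.comp G).comp H = F.comp (G.comp H) := by
  refine pseudofunctor_ext_of_prelax rfl (fun x => heq_of_eq ?_) (fun f g => heq_of_eq ?_)
  · change H.map₂ (G.map₂ (F.mapId x).hom ≫ (G.mapId _).hom) ≫ (H.mapId _).hom =
      H.map₂ (G.map₂ (F.mapId x).hom) ≫ H.map₂ (G.mapId _).hom ≫ (H.mapId _).hom
    rw [H.map₂_comp, Category.assoc]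
  · change H.map₂ (G.map₂ (F.mapComp f g).hom ≫ (G.mapComp _ _).hom) ≫ (H.mapComp _ _).hom =
      H.map₂ (G.map₂ (F.mapComp f g).hom) ≫ H.map₂ (G.mapComp _ _).hom ≫ (H.mapComp _ _).hom
    rw [H.map₂_comp, Category.assoc]

end PseudofunctorExt

section LocallyDiscreteTarget

universe w₁ v₁ u₁ v₂ u₂

variable {X : Type u₁} [Bicategory.{w₁, v₁} X] {C : Type u₂} [Category.{v₂} C]

/-- A pseudofunctor into a locally discrete bicategory, from its action on objects and 1-cells. All
coherence holds because there is at most one 2-cell between parallel 1-cells of the target. -/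
def toLocallyDiscrete (obj : X → C) (map : ∀ {x y : X}, (x ⟶ y) → (obj x ⟶ obj y))
    (map_eq : ∀ {x y : X} {f g : x ⟶ y}, (f ⟶ g) → map f = map g)
    (map_id : ∀ x, map (𝟙 x) = 𝟙 (obj x))
    (map_comp : ∀ {x y z : X} (f : x ⟶ y) (g : y ⟶ z), map (f ≫ g) = map f ≫ map g) :
    X ⥤ᵖ LocallyDiscrete C where
  obj x := ⟨obj x⟩
  map f := ⟨map f⟩
  map₂ η := eqToHom (congrArg Discrete.mk (map_eq η))
  map₂_id _ := Subsingleton.elim _ _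
  map₂_comp _ _ := Subsingleton.elim _ _
  mapId x := eqToIso (congrArg Discrete.mk (map_id x))
  mapComp f g := eqToIso (congrArg Discrete.mk (map_comp f g))
  map₂_whisker_left _ _ _ _ := Subsingleton.elim _ _
  map₂_whisker_right _ _ := Subsingleton.elim _ _
  map₂_associator _ _ _ := Subsingleton.elim _ _
  map₂_left_unitor _ := Subsingleton.elim _ _
  map₂_right_unitor _ := Subsingleton.elim _ _

theorem locallyDiscrete_ext {V W : X ⥤ᵖ LocallyDiscrete C} (hobj : ∀ x, V.obj x = W.obj x)
    (hmap : ∀ {x y : X} (f : x ⟶ y), HEq (V.map f) (W.map f)) : V = W := by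
  obtain ⟨⟨⟨⟨V₀, V₁⟩, V₂⟩⟩⟩ := V
  obtain ⟨⟨⟨⟨W₀, W₁⟩, W₂⟩⟩⟩ := W
  obtain rfl : V₀ = W₀ := funext hobj
  obtain rfl : @V₁ = @W₁ := by
    funext x y f
    exact eq_of_heq (hmap f)
  exact pseudofunctor_ext_of_prelax
    (prelaxFunctor_ext (fun _ => rfl) (fun _ => HEq.rfl)
      (fun _ => heq_of_eq (Subsingleton.elim _ _)))
    (fun _ => heq_of_eq (Subsingleton.elim _ _)) (fun _ _ => heq_of_eq (Subsingleton.elim _ _))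

theorem exists_eq_toLocallyDiscrete (V : X ⥤ᵖ LocallyDiscrete C) :
    ∃ (obj : X → C) (map : ∀ {x y : X}, (x ⟶ y) → (obj x ⟶ obj y)) (h₁ : _) (h₂ : _) (h₃ : _),
      V = toLocallyDiscrete obj map h₁ h₂ h₃ :=
  ⟨fun x => (V.obj x).as, fun f => (V.map f).as,
    fun η => congrArg Discrete.as (LocallyDiscrete.eq_of_hom (V.map₂ η)),
    fun x => congrArg Discrete.as (LocallyDiscrete.eq_of_hom (V.mapId x).hom),
    fun f g => congrArg Discrete.as (LocallyDiscrete.eq_of_hom (V.mapComp f g).hom),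
    locallyDiscrete_ext (fun _ => rfl) (fun _ => HEq.rfl)⟩

end LocallyDiscreteTarget

/-! ### Pseudofunctors into lax coslices and pullbacks of the projection -/

section Lifts

universe w v z w₁ v₁ u₁ w₂ v₂ u₂

variable {B : Type z} [Bicategory.{w, v} B] {I : B} {X : Type u₁} [Bicategory.{w₁, v₁} X]

/-- A lax cone from `I` to the pseudofunctor `G`: exactly what has to be added to `G` to lift it along
the projection of the lax coslice under `I`. -/
structure LiftData (G : X ⥤ᵖ B) (I : B) where
  pt (x : X) : I ⟶ G.obj x
  cell {x y : X} (f : x ⟶ y) : pt x ≫ G.map f ⟶ pt y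
  cell_map₂ {x y : X} {f g : x ⟶ y} (η : f ⟶ g) : pt x ◁ G.map₂ η ≫ cell g = cell f
  cell_id (x : X) : pt x ◁ (G.mapId x).hom ≫ (ρ_ (pt x)).hom = cell (𝟙 x)
  cell_comp {x y t : X} (f : x ⟶ y) (g : y ⟶ t) : pt x ◁ (G.mapComp f g).hom ≫
    (α_ (pt x) (G.map f) (G.map g)).inv ≫ cell f ▷ G.map g ≫ cell g = cell (f ≫ g)

namespace LiftData

/-- The pseudofunctor into the lax coslice determined by a lax cone over `G`. -/
def lift {G : X ⥤ᵖ B} (d : LiftData G I) : X ⥤ᵖ LaxCoslice B I where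
  obj x := ⟨G.obj x, d.pt x⟩
  map f := ⟨G.map f, d.cell f⟩
  map₂ η := ⟨G.map₂ η, d.cell_map₂ η⟩
  map₂_id f := LaxCoslice.hom₂_ext (G.map₂_id f)
  map₂_comp η θ := LaxCoslice.hom₂_ext (G.map₂_comp η θ)
  mapId x := LaxCoslice.mkIso (G.mapId x) (d.cell_id x)
  mapComp f g := LaxCoslice.mkIso (G.mapComp f g) (d.cell_comp f g)
  map₂_whisker_left f _ _ η := LaxCoslice.hom₂_ext (G.map₂_whisker_left f η)
  map₂_whisker_right η h := LaxCoslice.hom₂_ext (G.map₂_whisker_right η h)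
  map₂_associator f g h := LaxCoslice.hom₂_ext (G.map₂_associator f g h)
  map₂_left_unitor f := LaxCoslice.hom₂_ext (G.map₂_left_unitor f)
  map₂_right_unitor f := LaxCoslice.hom₂_ext (G.map₂_right_unitor f)

theorem lift_comp_proj {G : X ⥤ᵖ B} (d : LiftData G I) :
    d.lift.comp (LaxCoslice.proj B I).toPseudofunctor = G :=
  pseudofunctor_ext_of_prelax rfl (fun _ => heq_of_eq (Category.comp_id _))
    (fun _ _ => heq_of_eq (Category.comp_id _))

/-- The lax cone underlying a pseudofunctor into the lax coslice. -/
def ofPseudofunctor (U : X ⥤ᵖ LaxCoslice B I) :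
    LiftData (U.comp (LaxCoslice.proj B I).toPseudofunctor) I where
  pt x := (U.obj x).pt
  cell f := LaxCoslice.Hom.cell (U.map f)
  cell_map₂ η := LaxCoslice.Hom₂.w (U.map₂ η)
  cell_id x := (congrArg (fun k => (U.obj x).pt ◁ k ≫ (ρ_ (U.obj x).pt).hom)
    (Category.comp_id _)).trans (LaxCoslice.Hom₂.w (U.mapId x).hom)
  cell_comp f g := (congrArg (fun k => _ ◁ k ≫ _)
    (Category.comp_id _)).trans (LaxCoslice.Hom₂.w (U.mapComp f g).hom)

theorem lift_ofPseudofunctor (U : X ⥤ᵖ LaxCoslice B I) : (ofPseudofunctor U).lift = U :=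
  pseudofunctor_ext_of_prelax rfl
    (fun _ => heq_of_eq (LaxCoslice.hom₂_ext (Category.comp_id _)))
    (fun _ _ => heq_of_eq (LaxCoslice.hom₂_ext (Category.comp_id _)))

/-- Stated for a variable `G` so that it applies when `U` lies over `G` only propositionally. -/
theorem exists_eq_lift {G : X ⥤ᵖ B} (U : X ⥤ᵖ LaxCoslice B I)
    (h : U.comp (LaxCoslice.proj B I).toPseudofunctor = G) : ∃ d : LiftData G I, U = d.lift := by
  subst h
  exact ⟨ofPseudofunctor U, (lift_ofPseudofunctor U).symm⟩

theorem lift_congr {G G' : X ⥤ᵖ B} (h : G = G') (d : LiftData G I) (d' : LiftData G' I)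
    (hpt : ∀ x, HEq (d.pt x) (d'.pt x))
    (hcell : ∀ {x y : X} (f : x ⟶ y), HEq (d.cell f) (d'.cell f)) : d.lift = d'.lift := by
  subst h
  obtain ⟨p, c⟩ := d
  obtain ⟨p', c'⟩ := d'
  obtain rfl : p = p' := funext fun x => eq_of_heq (hpt x)
  obtain rfl : @c = @c' := by
    funext x y f
    exact eq_of_heq (hcell f)
  rfl

theorem eq_lift {G : X ⥤ᵖ B} (U : X ⥤ᵖ LaxCoslice B I) (d : LiftData G I)
    (h : U.comp (LaxCoslice.proj B I).toPseudofunctor = G)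
    (hpt : ∀ x, HEq (U.obj x).pt (d.pt x))
    (hcell : ∀ {x y : X} (f : x ⟶ y), HEq (LaxCoslice.Hom.cell (U.map f)) (d.cell f)) :
    U = d.lift :=
  (lift_ofPseudofunctor U).symm.trans (lift_congr h _ _ hpt hcell)

/-- Transport of a lax cone along an equality of pseudofunctors, with prescribed components. The
prescribed components make it possible to have them in a definitionally convenient form when the
two pseudofunctors agree on objects and 1-cells by definition. -/
def copy {G G' : X ⥤ᵖ B} (d : LiftData G I) (h : G = G') (pt : ∀ x, I ⟶ G'.obj x)
    (cell : ∀ {x y : X} (f : x ⟶ y), pt x ≫ G'.map f ⟶ pt y) (hpt : ∀ x, HEq (d.pt x) (pt x))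
    (hcell : ∀ {x y : X} (f : x ⟶ y), HEq (d.cell f) (cell f)) : LiftData G' I := by
  refine ⟨pt, cell, ?_, ?_, ?_⟩ <;> subst h <;> obtain ⟨p, c, h₁, h₂, h₃⟩ := d <;>
    obtain rfl : p = pt := funext fun x => eq_of_heq (hpt x)
  all_goals
    obtain rfl : @c = @cell := by
      funext x y f
      exact eq_of_heq (hcell f)
  exacts [h₁, h₂, h₃]

end LiftData

/-- A 2-cell of `LocallyDiscrete C` is an equality, so two cells obtained from the same cell by
whiskering with images of such 2-cells are equal over that equality. -/
theorem heq_cell_of_whiskerLeft_eq {C : Type u₂} [Category.{v₂} C] (e : LocallyDiscrete C ⥤ᵖ B)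
    {c c' : LocallyDiscrete C} {F F' G : c ⟶ c'} (hF : F = F') (η : F ⟶ G) (η' : F' ⟶ G)
    {r : I ⟶ e.obj c} {s : I ⟶ e.obj c'} {K : e.obj c ⟶ e.obj c'} (k : e.map G ⟶ K)
    (l : r ≫ K ⟶ s) {t : r ≫ e.map F ⟶ s} {t' : r ≫ e.map F' ⟶ s}
    (h : r ◁ (e.map₂ η ≫ k) ≫ l = t) (h' : r ◁ (e.map₂ η' ≫ k) ≫ l = t') : HEq t t' := by
  subst hF h h'
  rw [Subsingleton.elim η η']

/-- If `P` is the category of elements of `e` in the sense that its objects are the pairs of an object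
`c` and a 1-cell `I ⟶ e c`, and its morphisms the pairs of a morphism and a cell over it, then `P` is
the pullback of the projection of the lax coslice along `e`. The laws of the lax cones carry over
to `P` because they only state equalities of cells. -/
theorem isPullbackSquare_lift.{a₂, b₂, c₂, v₃, u₃} {C : Type u₂} [Category.{v₂} C]
    {P : Type u₃} [Category.{v₃} P] (q : P ⥤ C)
    (e : LocallyDiscrete C ⥤ᵖ B) (d : LiftData (q.toPseudofunctor.comp e) I)
    (hobj : Function.Bijective
      (fun X : P => (⟨q.obj X, d.pt ⟨X⟩⟩ : Σ c : C, (I ⟶ e.obj ⟨c⟩))))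
    (hmap : ∀ X Y : P, Function.Bijective
      (fun φ : X ⟶ Y => (⟨q.map φ, d.cell φ.toLoc⟩ :
        Σ F : q.obj X ⟶ q.obj Y, (d.pt ⟨X⟩ ≫ e.map F.toLoc ⟶ d.pt ⟨Y⟩)))) :
    IsPullbackSquare.{a₂, b₂, c₂} d.lift q.toPseudofunctor
      (LaxCoslice.proj B I).toPseudofunctor e where
  comm := d.lift_comp_proj
  existsUnique_lift := by
    intro X _ U V hUV
    refine existsUnique_of_exists_of_unique ?_ ?_
    · obtain ⟨d', rfl⟩ := LiftData.exists_eq_lift U hUV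
      obtain ⟨obj, map, h₁, h₂, h₃, rfl⟩ := exists_eq_toLocallyDiscrete V
      -- Lift the objects, then the 1-cells. Each time the corresponding components of `V` and of
      -- the lax cone become images of the lifts by substitution, so that no transport remains.
      choose W hW using fun x => hobj.2 ⟨obj x, d'.pt x⟩
      obtain rfl : obj = fun x => q.obj (W x) := funext fun x => (congrArg Sigma.fst (hW x)).symm
      obtain ⟨pt, cell, hm, hi, hc⟩ := d'
      obtain rfl : pt = fun x => d.pt ⟨W x⟩ :=
        funext fun x => eq_of_heq (Sigma.mk.inj_iff.1 (hW x)).2.symm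
      choose M hM using fun (x y : X) (f : x ⟶ y) => (hmap (W x) (W y)).2 ⟨map f, cell f⟩
      obtain rfl : @map = fun x y f => q.map (M x y f) := by
        funext x y f
        exact (congrArg Sigma.fst (hM x y f)).symm
      obtain rfl : @cell = fun x y f => d.cell (M x y f).toLoc := by
        funext x y f
        exact eq_of_heq (Sigma.mk.inj_iff.1 (hM x y f)).2.symm
      refine ⟨toLocallyDiscrete W (fun {x y} f => M x y f) ?_ ?_ ?_, ?_, ?_⟩
      · intro x y f g η
        refine (hmap _ _).1 (Sigma.ext (h₁ η) ?_)
        refine heq_cell_of_whiskerLeft_eq e (congrArg Quiver.Hom.toLoc (h₁ η))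
          (eqToHom (congrArg Quiver.Hom.toLoc (h₁ η)))
          (q.toPseudofunctor.map₂ (𝟙 (M x y g).toLoc)) (𝟙 _) (d.cell (M x y g).toLoc) ?_ ?_
        · rw [Category.comp_id]
          exact hm η
        · rw [Category.comp_id]
          exact d.cell_map₂ (𝟙 (M x y g).toLoc)
      · intro x
        refine (hmap _ _).1 (Sigma.ext ((h₂ x).trans (q.map_id _).symm) ?_)
        exact heq_cell_of_whiskerLeft_eq e
          (congrArg Quiver.Hom.toLoc ((h₂ x).trans (q.map_id _).symm))
          _ _ _ _ (hi x) (d.cell_id ⟨W x⟩)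
      · intro x y z f g
        refine (hmap _ _).1 (Sigma.ext ((h₃ f g).trans (q.map_comp _ _).symm) ?_)
        exact heq_cell_of_whiskerLeft_eq e
          (congrArg Quiver.Hom.toLoc ((h₃ f g).trans (q.map_comp _ _).symm))
          _ _ _ _ (hc f g) (d.cell_comp (M x y f).toLoc (M y z g).toLoc)
      · refine LiftData.eq_lift _ _ ?_ (fun _ => HEq.rfl) (fun _ => HEq.rfl)
        rw [pseudofunctor_comp_assoc, d.lift_comp_proj, ← pseudofunctor_comp_assoc]
        exact congrArg (fun V => Pseudofunctor.comp V e)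
          (locallyDiscrete_ext (fun _ => rfl) (fun _ => HEq.rfl))
      · exact locallyDiscrete_ext (fun _ => rfl) (fun _ => HEq.rfl)
    · intro W W' hW hW'
      obtain ⟨obj, map, h₁, h₂, h₃, rfl⟩ := exists_eq_toLocallyDiscrete W
      obtain ⟨obj', map', h₁', h₂', h₃', rfl⟩ := exists_eq_toLocallyDiscrete W'
      have hT := hW.1.trans hW'.1.symm
      have hq := hW.2.trans hW'.2.symm
      -- Each of the two composites determines one component of the pair to which `hobj` or `hmap`
      -- applies.
      obtain rfl : obj = obj' := funext fun x => hobj.1 (Sigma.ext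
        (congrArg LocallyDiscrete.as (pseudofunctor_obj_eq hq x))
        (LaxCoslice.mk.inj (pseudofunctor_obj_eq hT x)).2)
      obtain rfl : @map = @map' := by
        funext x y f
        exact (hmap _ _).1 (Sigma.ext
          (congrArg Discrete.as (eq_of_heq (pseudofunctor_map_heq hq f)))
          (LaxCoslice.Hom.mk.inj (eq_of_heq (pseudofunctor_map_heq hT f))).2)
      rfl

end Lifts

/-! ### Pushforwards, pullbacks and the adjunction between the two quantifiers -/

section Lifting

universe w v z

variable {B : Type z} [Bicategory.{w, v} B] {I : B}

theorem isPush_of_isIso {R S : LaxCoslice B I} (φ : R ⟶ S) [IsIso (LaxCoslice.Hom.cell φ)] :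
    IsPush (LaxCoslice.proj B I) φ := by
  intro T (N : S.base ⟶ T.base) χ h
  obtain ⟨M, α⟩ := φ
  obtain ⟨L, χ⟩ := χ
  have : IsIso α := ‹_›
  have h : L = M ≫ N := h
  subst h
  refine ⟨⟨N, inv (α ▷ N) ≫ (α_ R.pt M N).hom ≫ χ⟩, ⟨rfl, ?_⟩, ?_⟩
  · refine congrArg (LaxCoslice.Hom.mk (M ≫ N)) ?_
    change (α_ R.pt M N).inv ≫ α ▷ N ≫ inv (α ▷ N) ≫ (α_ R.pt M N).hom ≫ χ = χ
    simp
  · rintro ⟨N', β⟩ ⟨hN, hβ⟩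
    have hN : N' = N := hN
    subst hN
    refine congrArg (LaxCoslice.Hom.mk N') ?_
    have e : (α_ R.pt M N').inv ≫ α ▷ N' ≫ β = χ :=
      eq_of_heq (LaxCoslice.Hom.mk.inj hβ).2
    rw [← e]
    simp

/-- A 1-cell is a pullback if its cell is a right lifting. The condition for 1-cells `N` into the base
of `R` is the case `K = T.pt ≫ N`. -/
theorem isPull_of_bijective {R S : LaxCoslice B I} (φ : R ⟶ S)
    (h : ∀ K : I ⟶ R.base, Function.Bijective
      (fun γ : K ⟶ R.pt => γ ▷ LaxCoslice.Hom.base φ ≫ LaxCoslice.Hom.cell φ)) :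
    IsPull (LaxCoslice.proj B I) φ := by
  intro T (N : T.base ⟶ R.base) χ hχ
  obtain ⟨M, α⟩ := φ
  obtain ⟨L, χ⟩ := χ
  have hχ : L = N ≫ M := hχ
  subst hχ
  obtain ⟨γ, hγ⟩ := (h (T.pt ≫ N)).2 ((α_ T.pt N M).hom ≫ χ)
  have hγ : γ ▷ M ≫ α = (α_ T.pt N M).hom ≫ χ := hγ
  refine ⟨⟨N, γ⟩, ⟨rfl, ?_⟩, ?_⟩
  · refine congrArg (LaxCoslice.Hom.mk (N ≫ M)) ?_
    change (α_ T.pt N M).inv ≫ γ ▷ M ≫ α = χ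
    rw [hγ]
    simp
  · rintro ⟨N', β⟩ ⟨hN, hβ⟩
    have hN : N' = N := hN
    subst hN
    refine congrArg (LaxCoslice.Hom.mk N') ((h (T.pt ≫ N')).1 ?_)
    have e : (α_ T.pt N' M).inv ≫ β ▷ M ≫ α = χ := eq_of_heq (LaxCoslice.Hom.mk.inj hβ).2
    change β ▷ M ≫ α = γ ▷ M ≫ α
    rw [hγ, ← e]
    simp

end Lifting

section Quantifiers

variable {A B : DIST.{u}}

/-- The unit `r ↦ (m ↦ [m, r])` of `∃_M ⊣ ∀_M`. -/
def quantUnit (M : A ⟶ B) (R : (A.cat)ᵒᵖ ⥤ Type u) :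
    R ⟶ (forallAlong M).obj ((existsAlong M).obj R) where
  app x := ↾ fun r => ⟨fun _ m => Tensor.mk x.unop m r, by
    intro i j f
    rfl⟩
  naturality x y f := by
    ext r
    refine Subtype.ext (funext fun b => funext fun m => ?_)
    exact Tensor.glue (X := Distributor.row M (op b)) f.unop m r

/-- The counit `[m, z] ↦ z m` of `∃_M ⊣ ∀_M`. -/
def quantCounit (M : A ⟶ B) (S : (B.cat)ᵒᵖ ⥤ Type u) :
    (existsAlong M).obj ((forallAlong M).obj S) ⟶ S where
  app b := ↾ Tensor.lift (X := Distributor.row M b) (Y := (forallAlong M).obj S)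
    (fun _ m z => z.1 b.unop m) (fun _ _ _ _ _ => rfl)
  naturality b b' g := by
    ext t
    induction t using Tensor.ind with
    | h a m z => exact congrFun (z.2 g.unop) m

/-- The adjunction `∃_M ⊣ ∀_M`. -/
def quantAdj (M : A ⟶ B) : existsAlong M ⊣ forallAlong M where
  unit := { app := quantUnit M }
  counit :=
    { app := quantCounit M
      naturality := by
        intro S S' f
        ext b t
        induction t using Tensor.ind with
        | h a m z => rfl }
  left_triangle_components R := by
    ext b t
    induction t using Tensor.ind with
    | h a m r => rfl
  right_triangle_components S := rfl

/-- The canonical isomorphism `M ∘ R ≅ ∃_M R`. It is the identity on each value; only the actions of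
morphisms have different expressions. -/
def pushIso (M : A ⟶ B) (R : (A.cat)ᵒᵖ ⥤ Type u) :
    (presheafDist A).obj R ≫ M ≅ (presheafDist B).obj ((existsAlong M).obj R) :=
  NatIso.ofComponents (fun x => Iso.refl (Tensor (Distributor.row M x.1) R)) (by
    intro x y f
    ext t
    induction t using Tensor.ind with
    | h a m r =>
      exact congrArg (Tensor.mk (X := Distributor.row M y.1) (Y := R) a _) (R.map_id_apply _ r))

theorem whiskerRight_pushIso (M : A ⟶ B) {R R' : (A.cat)ᵒᵖ ⥤ Type u} (g : R ⟶ R') :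
    (presheafDist A).map g ▷ M ≫ (pushIso M R').hom =
      (pushIso M R).hom ≫ (presheafDist B).map ((existsAlong M).map g) := by
  apply Distributor.comp_hom_ext
  intros
  rfl

/-- The 2-cell `M ∘ ∀_M S ⇒ S`: the counit of `∃_M ⊣ ∀_M` read through `pushIso`. -/
def pullCell (M : A ⟶ B) (S : (B.cat)ᵒᵖ ⥤ Type u) :
    (presheafDist A).obj ((forallAlong M).obj S) ≫ M ⟶ (presheafDist B).obj S :=
  (pushIso M _).hom ≫ (presheafDist B).map ((quantAdj M).counit.app S)

/-- Transposition along `∃_M ⊣ ∀_M` is the correspondence between cells out of the pushforward and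
cells into the pullback. -/
theorem pushIso_comp_map (M : A ⟶ B) {R : (A.cat)ᵒᵖ ⥤ Type u} {S : (B.cat)ᵒᵖ ⥤ Type u}
    (f : (existsAlong M).obj R ⟶ S) :
    (pushIso M R).hom ≫ (presheafDist B).map f =
      (presheafDist A).map ((quantAdj M).homEquiv R S f) ▷ M ≫ pullCell M S := by
  rw [pullCell, ← Category.assoc, whiskerRight_pushIso, Category.assoc, ← Functor.map_comp]
  congr 2
  rw [← Adjunction.homEquiv_counit, Equiv.symm_apply_apply]

/-- Every distributor from `1` is, by definition, the one attached to its only column. -/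
theorem eq_presheafDist_obj (K : DIST.one ⟶ A) :
    (presheafDist A).obj (Distributor.col K ⟨⟨⟩⟩) = K := rfl

/-- Natural transformations between presheaves are the 2-cells between the distributors from `1`. -/
def presheafDistFullyFaithful (A : DIST.{u}) : (presheafDist A).FullyFaithful where
  preimage {R S} γ :=
    { app := fun x => γ.app (x, ⟨⟨⟩⟩)
      naturality := fun x y f => γ.naturality (X := (x, ⟨⟨⟩⟩)) (Y := (y, ⟨⟨⟩⟩)) (f, 𝟙 _) }

/-- `∀_M S` is a right lifting of `S` through `M`. -/
theorem whiskerRight_pullCell_bijective (M : A ⟶ B) (S : (B.cat)ᵒᵖ ⥤ Type u)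
    (K : DIST.one ⟶ A) : Function.Bijective
      (fun γ : K ⟶ (presheafDist A).obj ((forallAlong M).obj S) => γ ▷ M ≫ pullCell M S) := by
  rw [← eq_presheafDist_obj K]
  generalize Distributor.col K ⟨⟨⟩⟩ = R
  -- Both sides of the bijection are homs of presheaves, and the map is the inverse transposition.
  let e := (presheafDistFullyFaithful A).homEquiv.symm.trans
    (((quantAdj M).homEquiv R S).symm.trans ((presheafDistFullyFaithful B).homEquiv.trans
      ((pushIso M R).symm.homFromEquiv (Z := (presheafDist B).obj S))))
  have h : ∀ γ, e γ = γ ▷ M ≫ pullCell M S := by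
    intro γ
    obtain ⟨g, rfl⟩ := (presheafDistFullyFaithful A).homEquiv.surjective γ
    obtain ⟨f, rfl⟩ := ((quantAdj M).homEquiv R S).surjective g
    refine Eq.trans ?_ (pushIso_comp_map M f)
    simp only [e, Equiv.trans_apply, Equiv.symm_apply_apply]
    rfl
  exact (funext h : ⇑e = _) ▸ e.bijective

theorem isPush_pushIso (M : A ⟶ B) (R : (A.cat)ᵒᵖ ⥤ Type u) :
    IsPush PSH.p (R := PSH.of A R) (S := PSH.of B ((existsAlong M).obj R))
      ⟨M, (pushIso M R).hom⟩ :=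
  @isPush_of_isIso _ _ _ (PSH.of A R) (PSH.of B ((existsAlong M).obj R)) ⟨M, (pushIso M R).hom⟩
    (inferInstanceAs (IsIso (pushIso M R).hom))

theorem isPull_pullCell (M : A ⟶ B) (S : (B.cat)ᵒᵖ ⥤ Type u) :
    IsPull PSH.p (R := PSH.of A ((forallAlong M).obj S)) (S := PSH.of B S)
      ⟨M, pullCell M S⟩ :=
  isPull_of_bijective (R := PSH.of A ((forallAlong M).obj S)) (S := PSH.of B S) ⟨M, pullCell M S⟩
    (whiskerRight_pullCell_bijective M S)

theorem isBifibration_p : IsBifibrationOfBicategories PSH.p.{u} := by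
  constructor
  · rintro ⟨B, S⟩ A (M : A ⟶ B)
    exact ⟨PSH.of A ((forallAlong M).obj (Distributor.col S ⟨⟨⟩⟩)), ⟨M, pullCell M (Distributor.col S ⟨⟨⟩⟩)⟩, rfl,
      HEq.rfl, isPull_pullCell M (Distributor.col S ⟨⟨⟩⟩)⟩
  · rintro ⟨A, R⟩ B (M : A ⟶ B)
    exact ⟨PSH.of B ((existsAlong M).obj (Distributor.col R ⟨⟨⟩⟩)), ⟨M, (pushIso M (Distributor.col R ⟨⟨⟩⟩)).hom⟩, rfl,
      HEq.rfl, isPush_pushIso M (Distributor.col R ⟨⟨⟩⟩)⟩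

end Quantifiers

/-! ### The triple adjunction along a functor -/

section Hyperdoctrine

variable {A B : Cat.{u, u}} (F : A ⟶ B)

/-- The two forms of the covariant functor `a ↦ hom_B(b, F a)`, with identical values. -/
def rowPlusIso (b : (B : Type u)ᵒᵖ) :
    F.toFunctor ⋙ coyoneda.obj b ≅ Distributor.row (plusDist F) b :=
  NatIso.ofComponents (fun a => Iso.refl (b.unop ⟶ F.toFunctor.obj a)) (by
    intro a a' f
    ext h
    exact (Category.id_comp (h ≫ F.toFunctor.map f)).symm)

/-- The two forms of the presheaf `a ↦ hom_B(F a, b)`, with identical values. -/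
def colMinusIso (b : B) :
    F.toFunctor.op ⋙ yoneda.obj b ≅ Distributor.col (minusDist F) b :=
  NatIso.ofComponents (fun a => Iso.refl (F.toFunctor.obj a.unop ⟶ b)) (by
    intro a a' f
    ext h
    exact congrArg (F.toFunctor.map f.unop ≫ ·) (Category.comp_id h).symm)

/-- The isomorphism `Σ_F ≅ ∃_{F⁺}`, `[h, r] ↦ [h, r]`. -/
def sigmaIso : sigmaPsh F ≅ existsAlong (plusDist F) :=
  NatIso.ofComponents (fun R => NatIso.ofComponents
    (fun b =>
      { hom := ↾ Tensor.map (rowPlusIso F b).hom (𝟙 R)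
        inv := ↾ Tensor.map (rowPlusIso F b).inv (𝟙 R)
        hom_inv_id := by
          ext t
          induction t using Tensor.ind with
          | h a h r => rfl
        inv_hom_id := by
          ext t
          induction t using Tensor.ind with
          | h a h r => rfl })
    (by
      intro b b' g
      ext t
      induction t using Tensor.ind with
      | h a h r =>
        refine congrArg (fun k => Tensor.mk (X := Distributor.row (plusDist F) b') (Y := R) a k r)
          ?_
        have e : ∀ h : b.unop ⟶ F.toFunctor.obj a,
            g.unop ≫ h = g.unop ≫ h ≫ F.toFunctor.map (𝟙 a) := by
          intro h; simp
        exact e h))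
    (by
      intro R R' f
      ext b t
      induction t using Tensor.ind with
      | h a h r => rfl)

/-- The isomorphism `Π_F ≅ ∀_{F⁻}`, `z ↦ z`. -/
def piIso : piPsh F ≅ forallAlong (minusDist F) :=
  NatIso.ofComponents (fun R => NatIso.ofComponents
    (fun b =>
      { hom := ↾ Cotensor.map (colMinusIso F b.unop).inv (𝟙 R)
        inv := ↾ Cotensor.map (colMinusIso F b.unop).hom (𝟙 R)
        hom_inv_id := rfl
        inv_hom_id := rfl })
    (by
      intro b b' g
      ext z
      refine Subtype.ext (funext fun a => funext fun h => congrArg (z.1 a) ?_)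
      have e : ∀ h : F.toFunctor.obj a ⟶ b'.unop,
          h ≫ g.unop = F.toFunctor.map (𝟙 a) ≫ h ≫ g.unop := by
        intro h; simp
      exact e h))
    (by
      intro R R' f
      rfl)

/-- The isomorphism `F* ≅ ∀_{F⁺}`, `s ↦ (h ↦ S(h) s)`: the Yoneda lemma for `hom_B(-, F a)`. -/
def substIsoForall : substPsh F ≅ forallAlong (plusDist F) :=
  NatIso.ofComponents (fun S => NatIso.ofComponents
    (fun a =>
      { hom := ↾ fun s => ⟨fun b (h : b ⟶ F.toFunctor.obj a.unop) => S.map h.op s, by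
          intro b b' f
          funext h
          have e : ∀ h : b' ⟶ F.toFunctor.obj a.unop,
              S.map (f ≫ h ≫ F.toFunctor.map (𝟙 a.unop)).op s = S.map f.op (S.map h.op s) := by
            intro h
            rw [F.toFunctor.map_id, Category.comp_id]
            exact S.map_comp_apply h.op f.op s
          exact e h⟩
        inv := ↾ fun z => z.1 (F.toFunctor.obj a.unop) (𝟙 (F.toFunctor.obj a.unop))
        hom_inv_id := by
          ext s
          exact S.map_id_apply _ s
        inv_hom_id := by
          ext z
          refine Subtype.ext (funext fun b => funext fun h => ?_)
          have e : ∀ h : b ⟶ F.toFunctor.obj a.unop,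
              S.map h.op (z.1 (F.toFunctor.obj a.unop) (𝟙 (F.toFunctor.obj a.unop))) =
                z.1 b h := by
            intro h
            refine (congrFun (z.2 h) (𝟙 (F.toFunctor.obj a.unop))).symm.trans ?_
            refine congrArg (z.1 b) ?_
            change h ≫ 𝟙 _ ≫ F.toFunctor.map (𝟙 a.unop) = h
            simp
          exact e h })
    (by
      intro a a' f
      ext s
      refine Subtype.ext (funext fun b => funext fun h => ?_)
      have e : ∀ h : b ⟶ F.toFunctor.obj a'.unop,
          S.map h.op (S.map (F.toFunctor.map f.unop).op s) =
            S.map (𝟙 b ≫ h ≫ F.toFunctor.map f.unop).op s := by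
        intro h
        rw [Category.id_comp]
        exact (S.map_comp_apply (F.toFunctor.map f.unop).op h.op s).symm
      exact e h))
    (by
      intro S S' f
      ext a s
      refine Subtype.ext (funext fun b => funext fun h => ?_)
      exact (NatTrans.naturality_apply f _ s).symm)

/-- The relation `[𝟙, S(h) s] = [h, s]` in `(∃_{F⁻} S)(a)`. -/
theorem minusDist_mk_id_map (S : (B : Type u)ᵒᵖ ⥤ Type u) (a : A) (b : B) (h : F.toFunctor.obj a ⟶ b)
    (s : S.obj (op b)) :
    Tensor.mk (X := Distributor.row (minusDist F) (op a)) (Y := S) (F.toFunctor.obj a)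
      (𝟙 (F.toFunctor.obj a)) (S.map h.op s) =
    Tensor.mk (X := Distributor.row (minusDist F) (op a)) (Y := S) b h s := by
  refine (Tensor.glue (X := Distributor.row (minusDist F) (op a)) (Y := S) h
    (𝟙 (F.toFunctor.obj a)) s).trans ?_
  refine congrArg (fun k => Tensor.mk (X := Distributor.row (minusDist F) (op a)) (Y := S) b k s) ?_
  change F.toFunctor.map (𝟙 a) ≫ 𝟙 _ ≫ h = h
  simp

/-- The isomorphism `F* ≅ ∃_{F⁻}`, `s ↦ [𝟙, s]`: the co-Yoneda lemma for `hom_B(F a, -)`. -/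
def substIsoExists : substPsh F ≅ existsAlong (minusDist F) :=
  NatIso.ofComponents (fun S => NatIso.ofComponents
    (fun a =>
      { hom := ↾ fun s => Tensor.mk (X := Distributor.row (minusDist F) a) (Y := S)
          (F.toFunctor.obj a.unop) (𝟙 (F.toFunctor.obj a.unop)) s
        inv := ↾ Tensor.lift (X := Distributor.row (minusDist F) a) (Y := S)
          (fun b (h : F.toFunctor.obj a.unop ⟶ b) s => S.map h.op s) (by
            intro b b' f h s
            have e : ∀ h : F.toFunctor.obj a.unop ⟶ b, S.map h.op (S.map f.op s) =
                S.map (F.toFunctor.map (𝟙 a.unop) ≫ h ≫ f).op s := by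
              intro h; simp
            exact e h)
        hom_inv_id := by
          ext s
          exact S.map_id_apply _ s
        inv_hom_id := by
          ext t
          induction t using Tensor.ind with
          | h b h s => exact minusDist_mk_id_map F S a.unop b h s })
    (by
      intro a a' f
      ext s
      refine (minusDist_mk_id_map F S a'.unop _ (F.toFunctor.map f.unop) s).trans ?_
      refine congrArg (fun k => Tensor.mk (X := Distributor.row (minusDist F) a') (Y := S)
        (F.toFunctor.obj a.unop) k s) ?_
      change F.toFunctor.map f.unop = F.toFunctor.map f.unop ≫ 𝟙 _ ≫ 𝟙 _
      simp))
    (by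
      intro S S' f
      rfl)

/-- The adjunction `Σ_F ⊣ F*`, transported from `∃_{F⁺} ⊣ ∀_{F⁺}`. -/
def sigmaAdj : sigmaPsh F ⊣ substPsh F :=
  ((quantAdj (plusDist F)).ofNatIsoLeft (sigmaIso F).symm).ofNatIsoRight (substIsoForall F).symm

/-- The adjunction `F* ⊣ Π_F`, transported from `∃_{F⁻} ⊣ ∀_{F⁻}`. -/
def piAdj : substPsh F ⊣ piPsh F :=
  ((quantAdj (minusDist F)).ofNatIsoLeft (substIsoExists F).symm).ofNatIsoRight (piIso F).symm

theorem sigmaAdj_unit_app (R : (A : Type u)ᵒᵖ ⥤ Type u) (x : A) (y : R.obj (op x)) :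
    ((sigmaAdj F).unit.app R).app (op x) y =
      Tensor.mk (X := F.toFunctor ⋙ coyoneda.obj (op (F.toFunctor.obj x))) x
        (𝟙 (F.toFunctor.obj x)) y := rfl

theorem piAdj_counit_app (R : (A : Type u)ᵒᵖ ⥤ Type u) (x : A)
    (z : ((piPsh F).obj R).obj (op (F.toFunctor.obj x))) :
    ((piAdj F).counit.app R).app (op x) z = z.1 x (𝟙 (F.toFunctor.obj x)) := rfl

end Hyperdoctrine

/-! ### Cartesian and cocartesian morphisms of presheaves over functors -/

section Cartesian

theorem eq_base_of_isHomLift_pPlus {X Y : PshPlus.{u}} {F : X.base ⟶ Y.base} {φ : X ⟶ Y}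
    (h : pPlus.IsHomLift F φ) : F = PshPlus.Hom.base φ :=
  @IsHomLift.eq_of_isHomLift _ _ _ _ pPlus X Y F φ h

theorem eq_base_of_isHomLift_pMinus {X Y : PshMinus.{u}} {F : Y.base ⟶ X.base} {φ : X ⟶ Y}
    (h : pMinus.IsHomLift F.op φ) : F = PshMinus.Hom.base φ :=
  congrArg Quiver.Hom.unop (@IsHomLift.eq_of_isHomLift _ _ _ _ pMinus X Y F.op φ h)

/-- A morphism `(F, α)` of `Psh⁺` is cocartesian if every `R ⇒ F* S` factors uniquely through `α`. -/
theorem isStronglyCocartesian_pPlus {X Y : PshPlus.{u}} (φ : X ⟶ Y)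
    (h : ∀ S : (Y.base : Type u)ᵒᵖ ⥤ Type u, Function.Bijective (fun β : Y.pt ⟶ S =>
      PshPlus.Hom.cell φ ≫ Functor.whiskerLeft (PshPlus.Hom.base φ).toFunctor.op β)) :
    pPlus.IsStronglyCocartesian (PshPlus.Hom.base φ) φ where
  toIsHomLift := inferInstanceAs (pPlus.IsHomLift (pPlus.map φ) φ)
  universal_property' := by
    intro Z (G : Y.base ⟶ Z.base) χ hχ
    obtain ⟨F, α⟩ := φ
    obtain ⟨L, χ⟩ := χ
    obtain rfl : F ≫ G = L := eq_base_of_isHomLift_pPlus hχ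
    obtain ⟨β, hβ⟩ := (h (G.toFunctor.op ⋙ Z.pt)).2 χ
    refine ⟨⟨G, β⟩, ⟨inferInstanceAs (pPlus.IsHomLift (pPlus.map (X := Y) (Y := Z) ⟨G, β⟩) _),
      congrArg (PshPlus.Hom.mk (F ≫ G)) hβ⟩, ?_⟩
    rintro ⟨G', β'⟩ ⟨hG, hβ'⟩
    obtain rfl : G = G' := eq_base_of_isHomLift_pPlus hG
    exact congrArg (PshPlus.Hom.mk G)
      ((h _).1 ((eq_of_heq (PshPlus.Hom.mk.inj hβ').2).trans hβ.symm))

theorem isStronglyCartesian_pPlus {X Y : PshPlus.{u}} (φ : X ⟶ Y)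
    [IsIso (PshPlus.Hom.cell φ)] :
    pPlus.IsStronglyCartesian (PshPlus.Hom.base φ) φ where
  toIsHomLift := inferInstanceAs (pPlus.IsHomLift (pPlus.map φ) φ)
  universal_property' := by
    intro Z (G : Z.base ⟶ X.base) χ hχ
    obtain ⟨F, α⟩ := φ
    obtain ⟨L, χ⟩ := χ
    have : IsIso α := ‹_›
    obtain rfl : G ≫ F = L := eq_base_of_isHomLift_pPlus hχ
    let ι : G.toFunctor.op ⋙ X.pt ≅ (G ≫ F).toFunctor.op ⋙ Y.pt :=
      Functor.isoWhiskerLeft G.toFunctor.op (asIso α)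
    refine ⟨⟨G, χ ≫ ι.inv⟩,
      ⟨inferInstanceAs (pPlus.IsHomLift (pPlus.map (X := Z) (Y := X) ⟨G, χ ≫ ι.inv⟩) _),
        congrArg (PshPlus.Hom.mk (G ≫ F)) ((Iso.comp_inv_eq ι).1 rfl).symm⟩, ?_⟩
    rintro ⟨G', β'⟩ ⟨hG, hβ'⟩
    obtain rfl : G = G' := eq_base_of_isHomLift_pPlus hG
    exact congrArg (PshPlus.Hom.mk G)
      ((Iso.eq_comp_inv ι).2 (eq_of_heq (PshPlus.Hom.mk.inj hβ').2))

/-- A morphism `(F, α)` of `Psh⁻` is cartesian if every `F* T ⇒ S` factors uniquely through `α`. -/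
theorem isStronglyCartesian_pMinus {X Y : PshMinus.{u}} (φ : X ⟶ Y)
    (h : ∀ T : (X.base : Type u)ᵒᵖ ⥤ Type u, Function.Bijective (fun β : T ⟶ X.pt =>
      Functor.whiskerLeft (PshMinus.Hom.base φ).toFunctor.op β ≫ PshMinus.Hom.cell φ)) :
    pMinus.IsStronglyCartesian (PshMinus.Hom.base φ).op φ where
  toIsHomLift := inferInstanceAs (pMinus.IsHomLift (pMinus.map φ) φ)
  universal_property' := by
    intro Z g χ hχ
    obtain ⟨G, rfl⟩ : ∃ G : X.base ⟶ Z.base, g = G.op := ⟨g.unop, rfl⟩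
    obtain ⟨F, α⟩ := φ
    obtain ⟨L, χ⟩ := χ
    obtain rfl : F ≫ G = L := eq_base_of_isHomLift_pMinus hχ
    obtain ⟨β, hβ⟩ := (h (G.toFunctor.op ⋙ Z.pt)).2 χ
    refine ⟨⟨G, β⟩, ⟨inferInstanceAs (pMinus.IsHomLift (pMinus.map (X := Z) (Y := X) ⟨G, β⟩) _),
      congrArg (PshMinus.Hom.mk (F ≫ G)) hβ⟩, ?_⟩
    rintro ⟨G', β'⟩ ⟨hG, hβ'⟩
    obtain rfl : G = G' := eq_base_of_isHomLift_pMinus hG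
    exact congrArg (PshMinus.Hom.mk G)
      ((h _).1 ((eq_of_heq (PshMinus.Hom.mk.inj hβ').2).trans hβ.symm))

theorem isStronglyCocartesian_pMinus {X Y : PshMinus.{u}} (φ : X ⟶ Y)
    [IsIso (PshMinus.Hom.cell φ)] :
    pMinus.IsStronglyCocartesian (PshMinus.Hom.base φ).op φ where
  toIsHomLift := inferInstanceAs (pMinus.IsHomLift (pMinus.map φ) φ)
  universal_property' := by
    intro Z g χ hχ
    obtain ⟨G, rfl⟩ : ∃ G : Z.base ⟶ Y.base, g = G.op := ⟨g.unop, rfl⟩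
    obtain ⟨F, α⟩ := φ
    obtain ⟨L, χ⟩ := χ
    have : IsIso α := ‹_›
    obtain rfl : G ≫ F = L := eq_base_of_isHomLift_pMinus hχ
    let ι : (G ≫ F).toFunctor.op ⋙ X.pt ≅ G.toFunctor.op ⋙ Y.pt :=
      Functor.isoWhiskerLeft G.toFunctor.op (asIso α)
    refine ⟨⟨G, ι.inv ≫ χ⟩,
      ⟨inferInstanceAs (pMinus.IsHomLift (pMinus.map (X := Y) (Y := Z) ⟨G, ι.inv ≫ χ⟩) _),
        congrArg (PshMinus.Hom.mk (G ≫ F)) ((Iso.inv_comp_eq ι).1 rfl).symm⟩, ?_⟩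
    rintro ⟨G', β'⟩ ⟨hG, hβ'⟩
    obtain rfl : G = G' := eq_base_of_isHomLift_pMinus hG
    exact congrArg (PshMinus.Hom.mk G)
      ((Iso.eq_inv_comp ι).2 (eq_of_heq (PshMinus.Hom.mk.inj hβ').2))

variable {A B : Cat.{u, u}} (F : A ⟶ B)

theorem isStronglyCocartesian_sigmaAdj_unit (R : (A : Type u)ᵒᵖ ⥤ Type u) :
    pPlus.IsStronglyCocartesian F (a := PshPlus.mk A R) (b := PshPlus.mk B ((sigmaPsh F).obj R))
      ⟨F, (sigmaAdj F).unit.app R⟩ :=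
  isStronglyCocartesian_pPlus (X := PshPlus.mk A R) (Y := PshPlus.mk B ((sigmaPsh F).obj R))
    ⟨F, (sigmaAdj F).unit.app R⟩ (fun S =>
      (funext ((sigmaAdj F).homEquiv_unit R S) : ⇑((sigmaAdj F).homEquiv R S) = _) ▸
        ((sigmaAdj F).homEquiv R S).bijective)

theorem isStronglyCartesian_subst (S : (B : Type u)ᵒᵖ ⥤ Type u) :
    pPlus.IsStronglyCartesian F (a := PshPlus.mk A ((substPsh F).obj S)) (b := PshPlus.mk B S)
      ⟨F, 𝟙 _⟩ :=
  @isStronglyCartesian_pPlus (PshPlus.mk A ((substPsh F).obj S)) (PshPlus.mk B S) ⟨F, 𝟙 _⟩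
    (inferInstanceAs (IsIso (𝟙 ((substPsh F).obj S))))

theorem isStronglyCocartesian_subst (S : (B : Type u)ᵒᵖ ⥤ Type u) :
    pMinus.IsStronglyCocartesian F.op (a := PshMinus.mk B S)
      (b := PshMinus.mk A ((substPsh F).obj S)) ⟨F, 𝟙 _⟩ :=
  @isStronglyCocartesian_pMinus (PshMinus.mk B S) (PshMinus.mk A ((substPsh F).obj S)) ⟨F, 𝟙 _⟩
    (inferInstanceAs (IsIso (𝟙 ((substPsh F).obj S))))

theorem isStronglyCartesian_piAdj_counit (R : (A : Type u)ᵒᵖ ⥤ Type u) :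
    pMinus.IsStronglyCartesian F.op (a := PshMinus.mk B ((piPsh F).obj R))
      (b := PshMinus.mk A R) ⟨F, (piAdj F).counit.app R⟩ :=
  isStronglyCartesian_pMinus (X := PshMinus.mk B ((piPsh F).obj R)) (Y := PshMinus.mk A R)
    ⟨F, (piAdj F).counit.app R⟩ (fun T =>
      (funext ((piAdj F).homEquiv_counit T R) : ⇑((piAdj F).homEquiv T R).symm = _) ▸
        ((piAdj F).homEquiv T R).symm.bijective)

theorem isBifibration_pPlus : IsBifibration pPlus.{u} :=
  ⟨fun S _ f => ⟨_, _, isStronglyCartesian_subst f S.pt⟩,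
    fun R _ f => ⟨_, _, isStronglyCocartesian_sigmaAdj_unit f R.pt⟩⟩

theorem isBifibration_pMinus : IsBifibration pMinus.{u} :=
  ⟨fun S _ f => ⟨_, _, isStronglyCartesian_piAdj_counit f.unop S.pt⟩,
    fun R _ f => ⟨_, _, isStronglyCocartesian_subst f.unop R.pt⟩⟩

end Cartesian

/-! ### The pullback squares -/

section Squares

theorem toPSHPlus_comp_p : toPSHPlus.{u}.comp PSH.p.toPseudofunctor =
    pPlus.toPseudofunctor.comp embPlus := by
  refine pseudofunctor_ext_of_prelax
    (prelaxFunctor_ext (fun _ => rfl) (fun _ => HEq.rfl) ?_)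
    (fun x => heq_of_eq ?_) (fun f g => heq_of_eq ?_)
  · intro x y f g η
    obtain rfl := LocallyDiscrete.eq_of_hom η
    obtain rfl : η = 𝟙 f := Subsingleton.elim _ _
    exact heq_of_eq ((PrelaxFunctor.map₂_id _ _).trans (PrelaxFunctor.map₂_id _ _).symm)
  · refine (Category.comp_id _).trans (Eq.symm ?_)
    refine (congrArg (· ≫ _) (embPlus.map₂_id _)).trans (Category.id_comp _)
  · refine (Category.comp_id _).trans (Eq.symm ?_)
    refine (congrArg (· ≫ _) (embPlus.map₂_id _)).trans (Category.id_comp _)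

theorem toPSHMinus_comp_p : toPSHMinus.{u}.comp PSH.p.toPseudofunctor =
    pMinus.toPseudofunctor.comp embMinus := by
  refine pseudofunctor_ext_of_prelax
    (prelaxFunctor_ext (fun _ => rfl) (fun _ => HEq.rfl) ?_)
    (fun x => heq_of_eq ?_) (fun f g => heq_of_eq ?_)
  · intro x y f g η
    obtain rfl := LocallyDiscrete.eq_of_hom η
    obtain rfl : η = 𝟙 f := Subsingleton.elim _ _
    exact heq_of_eq ((PrelaxFunctor.map₂_id _ _).trans (PrelaxFunctor.map₂_id _ _).symm)
  · refine (Category.comp_id _).trans (Eq.symm ?_)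
    refine (congrArg (· ≫ _) (embMinus.map₂_id _)).trans (Category.id_comp _)
  · refine (Category.comp_id _).trans (Eq.symm ?_)
    refine (congrArg (· ≫ _) (embMinus.map₂_id _)).trans (Category.id_comp _)


/-- The Yoneda lemma: a cell `F⁺ ∘ R ⇒ S` is determined by its values at the classes `[𝟙, r]`, which
form an arbitrary transformation `R ⇒ F* S`. -/
theorem plusCell_bijective {X Y : PshPlus.{u}} (F : X.base ⟶ Y.base) :
    Function.Bijective
      (β := (presheafDist (DIST.of X.base)).obj X.pt ≫ plusDist F ⟶
        (presheafDist (DIST.of Y.base)).obj Y.pt)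
      (fun α : X.pt ⟶ F.toFunctor.op ⋙ Y.pt => plusCell (X := X) (Y := Y) ⟨F, α⟩) := by
  constructor
  · intro α β h
    ext x r
    have e := types_congr_hom (NatTrans.congr_app h (op (F.toFunctor.obj x.unop), ⟨⟨⟩⟩))
      (Tensor.mk (X := Distributor.row (plusDist F) (op (F.toFunctor.obj x.unop)))
        (Y := X.pt) x.unop (𝟙 (F.toFunctor.obj x.unop)) r)
    exact (Y.pt.map_id_apply _ _).symm.trans (Eq.trans e (Y.pt.map_id_apply _ _))
  · intro γ
    let κ := (presheafDistFullyFaithful (DIST.of Y.base)).preimage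
      ((pushIso (plusDist F) X.pt).inv ≫ γ)
    -- The transformation `r ↦ γ [𝟙, r]`.
    refine ⟨(sigmaAdj F).homEquiv X.pt Y.pt ((sigmaIso F).hom.app X.pt ≫ κ), ?_⟩
    apply Distributor.comp_hom_ext
    intro b s a h r
    have e : ∀ h : b.unop ⟶ F.toFunctor.obj a,
        Y.pt.map h.op (κ.app _ (Tensor.mk (X := Distributor.row (plusDist F) _) (Y := X.pt) a
          (𝟙 (F.toFunctor.obj a)) r)) =
        κ.app b (Tensor.mk (X := Distributor.row (plusDist F) b) (Y := X.pt) a h r) := by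
      intro h
      refine (NatTrans.naturality_apply κ h.op _).symm.trans (congrArg (κ.app b) ?_)
      refine congrArg (fun k => Tensor.mk (X := Distributor.row (plusDist F) b) (Y := X.pt) a k r) ?_
      change h ≫ 𝟙 _ ≫ F.toFunctor.map (𝟙 a) = h
      simp
    exact e h

/-- The co-Yoneda lemma: a cell `F⁻ ∘ R ⇒ S` is determined by its values at the classes `[𝟙, r]`, which
form an arbitrary transformation `F* R ⇒ S`. -/
theorem minusCell_bijective {X Y : PshMinus.{u}} (F : Y.base ⟶ X.base) :
    Function.Bijective
      (β := (presheafDist (DIST.of X.base)).obj X.pt ≫ minusDist F ⟶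
        (presheafDist (DIST.of Y.base)).obj Y.pt)
      (fun α : F.toFunctor.op ⋙ X.pt ⟶ Y.pt => minusCell (X := X) (Y := Y) ⟨F, α⟩) := by
  constructor
  · intro α β h
    ext y r
    have e := types_congr_hom (NatTrans.congr_app h (y, ⟨⟨⟩⟩))
      (Tensor.mk (X := Distributor.row (minusDist F) y)
        (Y := X.pt) (F.toFunctor.obj y.unop) (𝟙 (F.toFunctor.obj y.unop)) r)
    exact (congrArg (α.app y) (X.pt.map_id_apply _ _)).symm.trans
      (Eq.trans e (congrArg (β.app y) (X.pt.map_id_apply _ _)))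
  · intro γ
    let κ := (presheafDistFullyFaithful (DIST.of Y.base)).preimage
      ((pushIso (minusDist F) X.pt).inv ≫ γ)
    -- The transformation `r ↦ γ [𝟙, r]`.
    refine ⟨(substIsoExists F).hom.app X.pt ≫ κ, ?_⟩
    apply Distributor.comp_hom_ext
    intro b s a h r
    exact congrArg (κ.app b) (minusDist_mk_id_map F X.pt b.unop a h r)

/-- The lax cone given by the objects and morphisms of `Psh⁺`; its lift is `toPSHPlus`. -/
def plusLiftData : LiftData (pPlus.{u}.toPseudofunctor.comp embPlus) DIST.one :=
  (LiftData.ofPseudofunctor toPSHPlus).copy toPSHPlus_comp_p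
    (fun X => (presheafDist (DIST.of X.as.base)).obj X.as.pt) (fun f => plusCell f.as)
    (fun _ => HEq.rfl) (fun _ => HEq.rfl)

/-- The lax cone given by the objects and morphisms of `Psh⁻`; its lift is `toPSHMinus`. -/
def minusLiftData : LiftData (pMinus.{u}.toPseudofunctor.comp embMinus) DIST.one :=
  (LiftData.ofPseudofunctor toPSHMinus).copy toPSHMinus_comp_p
    (fun X => (presheafDist (DIST.of X.as.base)).obj X.as.pt) (fun f => minusCell f.as)
    (fun _ => HEq.rfl) (fun _ => HEq.rfl)

theorem presheafDist_obj_injective (A : DIST.{u}) :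
    Function.Injective (presheafDist A).obj := fun _ _ h =>
  congrArg (fun K : DIST.one ⟶ A => Distributor.col K ⟨⟨⟩⟩) h

theorem isPullbackSquare_plus :
    IsPullbackSquare.{a, b, c} toPSHPlus.{u} pPlus.toPseudofunctor PSH.p.toPseudofunctor
      embPlus := by
  have h : toPSHPlus.{u} = plusLiftData.lift :=
    LiftData.eq_lift _ _ toPSHPlus_comp_p (fun _ => HEq.rfl) (fun _ => HEq.rfl)
  rw [h]
  refine isPullbackSquare_lift pPlus embPlus plusLiftData ⟨?_, ?_⟩ fun X Y => ⟨?_, ?_⟩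
  · rintro ⟨A, R⟩ ⟨A', R'⟩ h
    obtain ⟨h₁, h₂⟩ := Sigma.mk.inj_iff.1 h
    obtain rfl : A = A' := h₁
    exact congrArg (PshPlus.mk A) (presheafDist_obj_injective _ (eq_of_heq h₂))
  · rintro ⟨A, K⟩
    exact ⟨⟨A, Distributor.col K ⟨⟨⟩⟩⟩, rfl⟩
  · rintro ⟨F, α⟩ ⟨F', α'⟩ h
    obtain ⟨h₁, h₂⟩ := Sigma.mk.inj_iff.1 h
    obtain rfl : F = F' := h₁
    exact congrArg (PshPlus.Hom.mk F) ((plusCell_bijective F).1 (eq_of_heq h₂))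
  · rintro ⟨F, γ⟩
    obtain ⟨α, rfl⟩ := (plusCell_bijective F).2 γ
    exact ⟨⟨F, α⟩, rfl⟩

theorem isPullbackSquare_minus :
    IsPullbackSquare.{a, b, c} toPSHMinus.{u} pMinus.toPseudofunctor PSH.p.toPseudofunctor
      embMinus := by
  have h : toPSHMinus.{u} = minusLiftData.lift :=
    LiftData.eq_lift _ _ toPSHMinus_comp_p (fun _ => HEq.rfl) (fun _ => HEq.rfl)
  rw [h]
  refine isPullbackSquare_lift pMinus embMinus minusLiftData ⟨?_, ?_⟩ fun X Y => ⟨?_, ?_⟩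
  · rintro ⟨A, R⟩ ⟨A', R'⟩ h
    obtain ⟨h₁, h₂⟩ := Sigma.mk.inj_iff.1 h
    obtain rfl : A = A' := congrArg unop h₁
    exact congrArg (PshMinus.mk A) (presheafDist_obj_injective _ (eq_of_heq h₂))
  · rintro ⟨A, K⟩
    exact ⟨⟨A.unop, Distributor.col K ⟨⟨⟩⟩⟩, rfl⟩
  · rintro ⟨F, α⟩ ⟨F', α'⟩ h
    obtain ⟨h₁, h₂⟩ := Sigma.mk.inj_iff.1 h
    obtain rfl : F = F' := congrArg Quiver.Hom.unop h₁
    exact congrArg (PshMinus.Hom.mk F) ((minusCell_bijective F).1 (eq_of_heq h₂))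
  · rintro ⟨F, γ⟩
    obtain ⟨α, rfl⟩ := (minusCell_bijective (Quiver.Hom.unop F)).2 γ
    exact ⟨⟨Quiver.Hom.unop F, α⟩, rfl⟩

end Squares

end PresheafBifibration

theorem mainTheorem5 :
    -- `p : PSH → Dist`, `p⁺ : Psh⁺ → Cat` and `p⁻ : Psh⁻ → Catᵒᵖ` are bifibrations
    IsBifibrationOfBicategories PSH.p.{u} ∧ IsBifibration pPlus.{u} ∧ IsBifibration pMinus.{u} ∧
    -- `p⁺` and `p⁻` are the pullbacks of `p` along the two embeddings
    IsPullbackSquare.{a, b, c} toPSHPlus.{u} pPlus.toPseudofunctor PSH.p.toPseudofunctor embPlus ∧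
    IsPullbackSquare.{a, b, c} toPSHMinus.{u} pMinus.toPseudofunctor PSH.p.toPseudofunctor
      embMinus ∧
    -- the adjunctions `∃_M ⊣ ∀_M` between the coend and end formulas
    ∃ quant : ∀ {A B : DIST.{u}} (M : A ⟶ B), existsAlong M ⊣ forallAlong M,
      (∀ {A B : DIST.{u}} (M : A ⟶ B),
        (∀ (R : (A.cat)ᵒᵖ ⥤ Type u) (x : A.cat) (r : R.obj (op x)) (y : B.cat)
          (m : (Distributor.row M (op y)).obj x),
          (((quant M).unit.app R).app (op x) r).1 y m = Tensor.mk x m r) ∧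
        -- `∃_M` and `∀_M` are the pushforward and the pullback along `M` in `p`, and `∃_M ⊣ ∀_M`
        -- is the resulting correspondence of derivations over `M`
        ∃ (push : ∀ R : (A.cat)ᵒᵖ ⥤ Type u, (presheafDist A).obj R ≫ M ⟶
            (presheafDist B).obj ((existsAlong M).obj R))
          (pull : ∀ S : (B.cat)ᵒᵖ ⥤ Type u,
            (presheafDist A).obj ((forallAlong M).obj S) ≫ M ⟶ (presheafDist B).obj S),
          (∀ R, IsPush PSH.p (R := PSH.of A R) (S := PSH.of B ((existsAlong M).obj R))
            ⟨M, push R⟩) ∧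
          (∀ S, IsPull PSH.p (R := PSH.of A ((forallAlong M).obj S)) (S := PSH.of B S)
            ⟨M, pull S⟩) ∧
          ∀ R S (f : (existsAlong M).obj R ⟶ S),
            push R ≫ (presheafDist B).map f =
              (presheafDist A).map ((quant M).homEquiv R S f) ▷ M ≫ pull S) ∧
      -- the triple adjunction `Σ_F ⊣ F* ⊣ Π_F`
      ∀ {A B : Cat.{u, u}} (F : A ⟶ B),
        ∃ (adjS : sigmaPsh F ⊣ substPsh F) (adjP : substPsh F ⊣ piPsh F)
          (s : sigmaPsh F ≅ existsAlong (plusDist F)) (t : substPsh F ≅ forallAlong (plusDist F))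
          (t' : substPsh F ≅ existsAlong (minusDist F)) (r : piPsh F ≅ forallAlong (minusDist F)),
          -- the adjunctions have the canonical unit and counit
          (∀ (R : (A : Type u)ᵒᵖ ⥤ Type u) (x : A) (y : R.obj (op x)),
            (adjS.unit.app R).app (op x) y =
              Tensor.mk (X := F.toFunctor ⋙ coyoneda.obj (op (F.toFunctor.obj x))) x
                (𝟙 (F.toFunctor.obj x)) y) ∧
          (∀ (R : (A : Type u)ᵒᵖ ⥤ Type u) (x : A)
            (z : ((piPsh F).obj R).obj (op (F.toFunctor.obj x))),
            (adjP.counit.app R).app (op x) z = z.1 x (𝟙 (F.toFunctor.obj x))) ∧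
          -- the comparisons are the canonical ones
          (∀ (R : (A : Type u)ᵒᵖ ⥤ Type u) (b : B) (x : A) (h : b ⟶ F.toFunctor.obj x)
            (y : R.obj (op x)),
            (s.hom.app R).app (op b)
              (Tensor.mk (X := F.toFunctor ⋙ coyoneda.obj (op b)) x h y) =
              Tensor.mk (X := Distributor.row (plusDist F) (op b)) x h y) ∧
          (∀ (S : (B : Type u)ᵒᵖ ⥤ Type u) (x : A) (y : S.obj (op (F.toFunctor.obj x))) (b : B)
            (h : b ⟶ F.toFunctor.obj x),
            ((t.hom.app S).app (op x) y).1 b h = S.map h.op y) ∧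
          (∀ (S : (B : Type u)ᵒᵖ ⥤ Type u) (x : A) (y : S.obj (op (F.toFunctor.obj x))),
            (t'.hom.app S).app (op x) y =
              Tensor.mk (X := Distributor.row (minusDist F) (op x)) (F.toFunctor.obj x)
                (𝟙 (F.toFunctor.obj x)) y) ∧
          (∀ (R : (A : Type u)ᵒᵖ ⥤ Type u) (b : B) (z : ((piPsh F).obj R).obj (op b)) (x : A)
            (h : F.toFunctor.obj x ⟶ b),
            ((r.hom.app R).app (op b) z).1 x h = z.1 x h) ∧
          -- they identify the triple adjunction with the adjunctions along `F⁺` and `F⁻`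
          adjS = ((quant (plusDist F)).ofNatIsoLeft s.symm).ofNatIsoRight t.symm ∧
          adjP = ((quant (minusDist F)).ofNatIsoLeft t'.symm).ofNatIsoRight r.symm ∧
          -- `p⁺` and `p⁻` encode the hyperdoctrine
          (∀ R : (A : Type u)ᵒᵖ ⥤ Type u, pPlus.IsStronglyCocartesian F
            (a := PshPlus.mk A R) (b := PshPlus.mk B ((sigmaPsh F).obj R))
            ⟨F, adjS.unit.app R⟩) ∧
          (∀ S : (B : Type u)ᵒᵖ ⥤ Type u, pPlus.IsStronglyCartesian F
            (a := PshPlus.mk A ((substPsh F).obj S)) (b := PshPlus.mk B S) ⟨F, 𝟙 _⟩) ∧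
          (∀ S : (B : Type u)ᵒᵖ ⥤ Type u, pMinus.IsStronglyCocartesian F.op
            (a := PshMinus.mk B S) (b := PshMinus.mk A ((substPsh F).obj S)) ⟨F, 𝟙 _⟩) ∧
          (∀ R : (A : Type u)ᵒᵖ ⥤ Type u, pMinus.IsStronglyCartesian F.op
            (a := PshMinus.mk B ((piPsh F).obj R)) (b := PshMinus.mk A R)
            ⟨F, adjP.counit.app R⟩) := by
  refine ⟨isBifibration_p, isBifibration_pPlus, isBifibration_pMinus, isPullbackSquare_plus,
    isPullbackSquare_minus, fun M => quantAdj M, fun M => ⟨fun _ _ _ _ _ => rfl,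
      fun R => (pushIso M R).hom, pullCell M, isPush_pushIso M, isPull_pullCell M,
      fun _ _ f => pushIso_comp_map M f⟩, fun F => ?_⟩
  exact ⟨sigmaAdj F, piAdj F, sigmaIso F, substIsoForall F, substIsoExists F, piIso F,
    sigmaAdj_unit_app F, piAdj_counit_app F, fun _ _ _ _ _ => rfl, fun _ _ _ _ _ => rfl,
    fun _ _ _ => rfl, fun _ _ _ _ _ => rfl, rfl, rfl, isStronglyCocartesian_sigmaAdj_unit F,
    isStronglyCartesian_subst F, isStronglyCocartesian_subst F,
    isStronglyCartesian_piAdj_counit F⟩
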